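/- Let $\mathcal K$ be a locally finitely presentable category and let $\mathcal L\subseteq\mathcal K$ be a definable subcategory, i.e. a full subcategory closed in $\mathcal K$ under products, directed colimits and pure subobjects. For a category $\mathcal A$ with products and directed colimits let $\mathcal A^+$ denote the category of functors $\mathcal A\to\mathrm{Set}$ that preserve products and directed colimits, with natural transformations as morphisms. Let $\mathrm{EX}$ denote the 2-category of (essentially) small Barr-exact categories, regular functors (functors preserving finite limits and regular epimorphisms) and natural transformations. Then the functor $Q:\mathcal K^+\to\mathcal L^+$ given by precomposition with the inclusion $\mathcal L\to\mathcal K$ is an epimorphism in $\mathrm{EX}$, in the 2-categorical sense: $\mathcal K^+$ and $\mathcal L^+$ are essentially small exact categories, $Q$ is a regular functor, and for every small exact category $\mathcal B$ and all regular functors $P_1,P_2:\mathcal L^+\to\mathcal B$, every natural transformation $\alpha:P_1\circ Q\Rightarrow P_2\circ Q$ is of the form $\beta Q$ for a unique natural transformation $\beta:P_1\Rightarrow P_2$. In particular, $P_1\circ Q\cong P_2\circ Q$ implies $P_1\cong P_2$. -/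

import Mathlib

open CategoryTheory Limits

universe u w a b v₁ u₁ v₂ u₂

namespace DefinableCat

/-! ### Definable subcategories of locally finitely presentable categories -/

/-- A morphism `f : A ⟶ B` is pure if in every commutative square
`g ≫ f = h ≫ k` with `h : X ⟶ Y` a morphism between finitely presentable objects,
`g` factors through `h`. -/
def IsPure {K : Type w} [Category.{u} K] {A B : K} (f : A ⟶ B) : Prop :=
  ∀ ⦃X Y : K⦄ [IsFinitelyPresentable.{u} X] [IsFinitelyPresentable.{u} Y]
    (h : X ⟶ Y) (g : X ⟶ A) (k : Y ⟶ B), g ≫ f = h ≫ k → ∃ d : Y ⟶ A, h ≫ d = g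

/-- A full subcategory of `K` (given by a property of objects) is definable if it is closed in `K`
under small products, colimits of small directed diagrams, and pure subobjects. -/
structure IsDefinable {K : Type w} [Category.{u} K] (L : ObjectProperty K) : Prop where
  products : ∀ J : Type u, L.IsClosedUnderLimitsOfShape (Discrete J)
  directedColimits : ∀ (J : Type u) [PartialOrder J] [IsDirectedOrder J] [Nonempty J],
    L.IsClosedUnderColimitsOfShape J
  pureSubobjects : ∀ ⦃A B : K⦄ (f : A ⟶ B) [Mono f], IsPure f → L B → L A

/-! ### The category `A⁺` -/

/-- The `Set`-valued functors that preserve small products and directed colimits. -/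
def IsInterpretation (A : Type w) [Category.{u} A] : ObjectProperty (A ⥤ Type u) := fun F =>
  (∀ J : Type u, PreservesLimitsOfShape (Discrete J) F) ∧
  (∀ (J : Type u) [PartialOrder J] [IsDirectedOrder J] [Nonempty J], PreservesColimitsOfShape J F)

/-- `A⁺`: the category of functors `A ⥤ Set` preserving small products and directed colimits, with
all natural transformations between them. -/
abbrev Plus (A : Type w) [Category.{u} A] := (IsInterpretation A).FullSubcategory

/-! ### Small exact categories and regular functors -/

/-- A (Barr-)exact category: a regular category in which every internal equivalence relation is
a kernel pair. -/
structure IsExact (C : Type u₁) [Category.{v₁} C] : Prop where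
  regular : Regular C
  effective : ∀ ⦃R X : C⦄ (p₁ p₂ : R ⟶ X), IsEquivalenceRelation p₁ p₂ →
    ∃ (Y : C) (f : X ⟶ Y), IsKernelPair f p₁ p₂

/-- The objects of `EX`: exact categories that are small, up to equivalence. -/
structure IsSmallExact (C : Type u₁) [Category.{v₁} C] : Prop where
  small : EssentiallySmall.{u} C
  exact : IsExact C

/-- A functor is regular if it preserves finite limits and regular epimorphisms. -/
structure IsRegularFunctor {C : Type u₁} [Category.{v₁} C] {D : Type u₂} [Category.{v₂} D]
    (F : C ⥤ D) : Prop where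
  lex : PreservesFiniteLimits F
  regularEpi : ∀ ⦃X Y : C⦄ (f : X ⟶ Y), IsRegularEpi f → IsRegularEpi (F.map f)

/-- `Q : C ⥤ D` is an epimorphism in the 2-category `EX` of small exact categories, regular functors
and natural transformations: it is a 1-morphism of `EX`, and for every small exact category `B`
precomposition with `Q` is a fully faithful functor `Reg(D, B) ⥤ Reg(C, B)`. In particular,
`Q ⋙ P₁ ≅ Q ⋙ P₂` implies `P₁ ≅ P₂` for regular functors `P₁`, `P₂`. -/
structure IsEpiEX {C : Type u₁} [Category.{v₁} C]
    {D : Type u₂} [Category.{v₂} D] (Q : C ⥤ D) : Prop where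
  source : IsSmallExact.{u} C
  target : IsSmallExact.{u} D
  regular : IsRegularFunctor Q
  epi : ∀ (B : Type a) [Category.{b} B], IsSmallExact.{u} B →
    ∀ P₁ P₂ : D ⥤ B, IsRegularFunctor P₁ → IsRegularFunctor P₂ →
      ∀ α : Q ⋙ P₁ ⟶ Q ⋙ P₂, ∃! β : P₁ ⟶ P₂, Functor.whiskerLeft Q β = α

/-! ### The restriction functor -/

section
variable {K : Type w} [Category.{u} K]

/-- A locally finitely presentable category is complete, being reflective in presheaves on
(a small model of) its finitely presentable objects. -/
theorem hasLimits_of_lfp [IsLocallyFinitelyPresentable.{u} K] : HasLimitsOfSize.{u, u} K := by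
  let P := ObjectProperty.isFinitelyPresentable.{u} K
  have : EssentiallySmall.{u} P.FullSubcategory := inferInstance
  let F : SmallModel.{u} P.FullSubcategory ⥤ K :=
    (equivSmallModel.{u} P.FullSubcategory).inverse ⋙ P.ι
  have : F.IsDense := inferInstance
  let adj := Presheaf.uliftYonedaAdjunction.{u} (uliftYoneda.{u}.leftKanExtension F)
    (uliftYoneda.{u}.leftKanExtensionUnit F)
  let : Reflective (Presheaf.restrictedULiftYoneda.{u} F) := ⟨_, adj⟩
  exact hasLimits_of_reflective (Presheaf.restrictedULiftYoneda.{u} F)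

/-- The inclusion of a definable subcategory preserves products and directed colimits, hence so
does the restriction to it of every functor in `K⁺`. -/
theorem IsDefinable.isInterpretation_restrict [IsLocallyFinitelyPresentable.{u} K]
    {L : ObjectProperty K} (hL : IsDefinable L) {F : K ⥤ Type u} (hF : IsInterpretation K F) :
    IsInterpretation L.FullSubcategory (L.ι ⋙ F) := by
  have := hasLimits_of_lfp (K := K)
  refine ⟨fun J => ?_, fun J _ _ _ => ?_⟩
  · have := hF.1 J
    have := hL.products J
    have : PreservesLimitsOfShape (Discrete J) L.ι := ⟨fun {D} => by
      have := createsLimitFullSubcategoryInclusion D (L.prop_limit _ fun j => (D.obj j).property)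
      infer_instance⟩
    infer_instance
  · have := hF.2 J
    have := hL.directedColimits J
    have : PreservesColimitsOfShape J L.ι := ⟨fun {D} => by
      have := createsColimitFullSubcategoryInclusion D
        (L.prop_colimit _ fun j => (D.obj j).property)
      infer_instance⟩
    infer_instance

/-- The functor `K⁺ ⥤ L⁺` given by precomposition with the inclusion `L ⥤ K`. -/
def restriction [IsLocallyFinitelyPresentable.{u} K] {L : ObjectProperty K} (hL : IsDefinable L) :
    Plus K ⥤ Plus L.FullSubcategory :=
  (IsInterpretation L.FullSubcategory).lift
    ((IsInterpretation K).ι ⋙ (Functor.whiskeringLeft _ _ _).obj L.ι)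
    (fun F => hL.isInterpretation_restrict F.property)

end

end DefinableCat

/-
A regular functor `Q` of exact categories is an epimorphism as soon as every object of its target is
a regular quotient of some `Q X` and every subobject of `Q X` is covered by the image under `Q` of a
morphism to `X`: the first condition presents an object by `Q X` and a kernel pair inside some
`Q (X × X)`, the second shows that a transformation on the image of `Q` respects this kernel pair.

For a definable subcategory `L` such covers come from finitely presentable objects `C` of `K`. By a
Löwenheim–Skolem argument, `L` has a small family of objects through which all elements of all
interpretations factor; hence an interpretation `F` of `L` has an element `x` of some `F P` that
generates `F`. Write `P` in `K` as the directed colimit of finitely presentable objects `C_i`. A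
family of objects of `L` indexed by `i` has a reduced product in `L`, the colimit of the products of
its tails, and `F` commutes with it. So what holds for `x` in such a reduced product holds at all
late stages `i`: `x` comes from a morphism `K(C_i, -) ⟶ F` on `L` for some `i`, and two such
morphisms that agree at `P` agree at a later stage. Since `x` generates `F`, this morphism
is a cover.
-/

open Opposite

namespace DefinableCat

/-! ### Finitely presentable objects and pure morphisms -/

section
variable {K : Type w} [Category.{u} K]

attribute [local instance] Cardinal.fact_isRegular_aleph0

theorem isFinitelyPresentable_colimit {J : Type} [SmallCategory J] [FinCategory J]
    (D : J ⥤ K) [HasColimit D] (h : ∀ j, IsFinitelyPresentable.{u} (D.obj j)) :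
    IsFinitelyPresentable.{u} (colimit D) := by
  have : ∀ j, IsCardinalPresentable (D.obj j) Cardinal.aleph0.{u} := h
  exact isCardinalPresentable_of_isColimit' _ (colimit.isColimit D) _
    (hasCardinalLT_of_finite _ _ le_rfl)

theorem exists_small_family_of_essentiallySmall (P : ObjectProperty K)
    [ObjectProperty.EssentiallySmall.{u} P] :
    ∃ (T : Type u) (S : T → K), (∀ t, P (S t)) ∧ ∀ X : K, P X → ∃ t, Nonempty (X ≅ S t) := by
  obtain ⟨Q, _, hQP, hPQ⟩ := ObjectProperty.EssentiallySmall.exists_small_le.{u} P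
  refine ⟨Shrink.{u} (Subtype Q), fun t => ((equivShrink _).symm t).1,
    fun t => hQP _ ((equivShrink _).symm t).2, fun X hX => ?_⟩
  obtain ⟨Y, hY, ⟨e⟩⟩ := hPQ X hX
  exact ⟨equivShrink _ ⟨Y, hY⟩, ⟨e ≪≫ eqToIso (by simp)⟩⟩

variable [IsLocallyFinitelyPresentable.{u} K]

theorem exists_directed_presentation (N : K) :
    ∃ (α : Type u) (_ : PartialOrder α) (_ : IsDirectedOrder α) (_ : Nonempty α)
      (p : ColimitPresentation α N), ∀ i, IsFinitelyPresentable.{u} (p.diag.obj i) := by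
  obtain ⟨J, _, hJ, ⟨p⟩⟩ := (isCardinalFilteredGenerator_isCardinalPresentable K
    Cardinal.aleph0.{u}).exists_colimitsOfShape N
  have : IsFiltered J := (isCardinalFiltered_aleph0_iff.{u} J).1 hJ
  obtain ⟨α, _, h, _, F, _⟩ := IsFiltered.exists_directed J
  exact ⟨α, _, h, ‹_›, p.toColimitPresentation.reindex F, fun i => p.prop_diag_obj _⟩

theorem hom_ext_of_finitelyPresentable {A B : K} {f g : A ⟶ B}
    (h : ∀ (Z : K) [IsFinitelyPresentable.{u} Z] (x : Z ⟶ A), x ≫ f = x ≫ g) : f = g := by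
  obtain ⟨α, _, _, _, p, hp⟩ := exists_directed_presentation A
  exact p.isColimit.hom_ext fun i => h _ _

theorem IsPure.mono {A B : K} {f : A ⟶ B} (hf : IsPure f) : Mono f := by
  refine ⟨fun {Z} y z hyz => hom_ext_of_finitelyPresentable fun X _ x => ?_⟩
  have : IsFinitelyPresentable.{u} (X ⨿ X) :=
    isFinitelyPresentable_colimit _ (by rintro ⟨_ | _⟩ <;> assumption)
  -- A pure morphism reflects the factorization of a pair of morphisms through the codiagonal.
  obtain ⟨d, hd⟩ := hf (coprod.desc (𝟙 X) (𝟙 X)) (coprod.desc (x ≫ y) (x ≫ z)) (x ≫ y ≫ f)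
    (by ext <;> simp [hyz])
  have hy : d = x ≫ y := by
    simpa only [coprod.desc_comp, coprod.inl_desc, Category.id_comp]
      using congrArg (coprod.inl ≫ ·) hd
  have hz : d = x ≫ z := by
    simpa only [coprod.desc_comp, coprod.inr_desc, Category.id_comp]
      using congrArg (coprod.inr ≫ ·) hd
  exact hy.symm.trans hz

end

/-! ### Restricting a directed colimit to subsets of its index poset -/

section
variable {K : Type w} [Category.{u} K] [HasColimitsOfSize.{u, u} K] {α : Type u} [Preorder α]

section
variable (D : α ⥤ K)

/-- The colimit of the restriction of a diagram to a subset of its indexing preorder. -/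
noncomputable def subColimit (A : Set α) : K :=
  colimit ((Subtype.mono_coe (· ∈ A)).functor ⋙ D)

/-- The structure morphisms of `subColimit`. -/
noncomputable def subColimitι {A : Set α} {x : α} (hx : x ∈ A) : D.obj x ⟶ subColimit D A :=
  colimit.ι ((Subtype.mono_coe (· ∈ A)).functor ⋙ D) ⟨x, hx⟩

theorem subColimitι_w {A : Set α} {x y : α} (hx : x ∈ A) (hy : y ∈ A) (h : x ≤ y) :
    D.map (homOfLE h) ≫ subColimitι D hy = subColimitι D hx :=
  colimit.w ((Subtype.mono_coe (· ∈ A)).functor ⋙ D)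
    (homOfLE h : (⟨x, hx⟩ : Subtype (· ∈ A)) ⟶ ⟨y, hy⟩)

variable {D}

theorem subColimit_hom_ext {A : Set α} {Z : K} {f g : subColimit D A ⟶ Z}
    (h : ∀ x (hx : x ∈ A), subColimitι D hx ≫ f = subColimitι D hx ≫ g) : f = g :=
  colimit.hom_ext fun x => h x.1 x.2

/-- The morphism out of `subColimit` given by its universal property. -/
noncomputable def subColimitDesc {A : Set α} {Z : K} (f : ∀ x ∈ A, (D.obj x ⟶ Z))
    (hf : ∀ x (hx : x ∈ A) y (hy : y ∈ A) (h : x ≤ y), D.map (homOfLE h) ≫ f y hy = f x hx) :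
    subColimit D A ⟶ Z :=
  colimit.desc _
    { pt := Z
      ι :=
        { app := fun x => f x.1 x.2
          naturality := fun x y h =>
            (hf x.1 x.2 y.1 y.2 (leOfHom h)).trans (Category.comp_id _).symm } }

theorem subColimitι_desc {A : Set α} {Z : K} (f : ∀ x ∈ A, (D.obj x ⟶ Z))
    (hf : ∀ x (hx : x ∈ A) y (hy : y ∈ A) (h : x ≤ y), D.map (homOfLE h) ≫ f y hy = f x hx)
    {x : α} (hx : x ∈ A) : subColimitι D hx ≫ subColimitDesc f hf = f x hx :=
  colimit.ι_desc _ _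

variable (D)

/-- The transition morphisms of `subColimit` along inclusions of subsets. -/
noncomputable def subColimitMap {A B : Set α} (h : A ⊆ B) : subColimit D A ⟶ subColimit D B :=
  subColimitDesc (fun _ hx => subColimitι D (h hx)) fun _ _ _ _ => subColimitι_w D _ _

@[simp]
theorem subColimitι_map {A B : Set α} (h : A ⊆ B) {x : α} (hx : x ∈ A) :
    subColimitι D hx ≫ subColimitMap D h = subColimitι D (h hx) :=
  subColimitι_desc ..

@[simp]
theorem subColimitι_map_assoc {A B : Set α} (h : A ⊆ B) {x : α} (hx : x ∈ A) {Z : K}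
    (f : subColimit D B ⟶ Z) :
    subColimitι D hx ≫ subColimitMap D h ≫ f = subColimitι D (h hx) ≫ f := by
  rw [← Category.assoc, subColimitι_map]

/-- The functor `subColimit` on a family of subsets of the index preorder. -/
noncomputable def subColimitFunctor (G : Set (Set α)) : G ⥤ K where
  obj A := subColimit D A.1
  map h := subColimitMap D (leOfHom h)
  map_id A := subColimit_hom_ext fun x hx => by simp
  map_comp f g := subColimit_hom_ext fun x hx => by simp

theorem exists_hom_subColimit {A : Set α} (hne : A.Nonempty) (hdir : DirectedOn (· ≤ ·) A) {X : K}
    [IsFinitelyPresentable.{u} X] (g : X ⟶ subColimit D A) :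
    ∃ (x : α) (hx : x ∈ A) (g' : X ⟶ D.obj x), g' ≫ subColimitι D hx = g := by
  have : Nonempty A := hne.to_subtype
  have : IsDirectedOrder A := ⟨directedOn_iff_directed.1 hdir⟩
  obtain ⟨x, g', h⟩ := IsFinitelyPresentable.exists_hom_of_isColimit
    (colimit.isColimit ((Subtype.mono_coe (· ∈ A)).functor ⋙ D)) g
  exact ⟨x.1, x.2, g', h⟩

end

section
variable {D : α ⥤ K} {G : Set (Set α)} (hG : DirectedOn (· ⊆ ·) G)

include hG in
theorem subColimitι_comp_app_eq (s : Cocone (subColimitFunctor D G)) {x : α} {A B : G}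
    (hA : x ∈ A.1) (hB : x ∈ B.1) :
    subColimitι D hA ≫ s.ι.app A = subColimitι D hB ≫ s.ι.app B := by
  obtain ⟨C, hC, hAC, hBC⟩ := hG A.1 A.2 B.1 B.2
  have app_eq (E : G) (hE : x ∈ E.1) (h : E.1 ⊆ C) :
      subColimitι D hE ≫ s.ι.app E = subColimitι D (h hE) ≫ s.ι.app ⟨C, hC⟩ := by
    rw [← s.w (homOfLE h : E ⟶ ⟨C, hC⟩)]
    exact subColimitι_map_assoc D h hE _
  exact (app_eq A hA hAC).trans (app_eq B hB hBC).symm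

/-- The cocone on a diagram induced by a cocone on the colimits of its restrictions to the members
of a directed cover of the index preorder; `c x` is a member containing `x`. -/
noncomputable def coconeOfSubsets {c : α → G} (hc : ∀ x, x ∈ (c x).1)
    (s : Cocone (subColimitFunctor D G)) : Cocone D where
  pt := s.pt
  ι :=
    { app := fun x => subColimitι D (hc x) ≫ s.ι.app (c x)
      naturality := fun x y f => by
        obtain ⟨C, hC, hx, hy⟩ := hG _ (c x).2 _ (c y).2
        rw [subColimitι_comp_app_eq hG s (B := ⟨C, hC⟩) (hc x) (hx (hc x)),
          subColimitι_comp_app_eq hG s (B := ⟨C, hC⟩) (hc y) (hy (hc y)),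
          ← subColimitι_w D (hx (hc x)) (hy (hc y)) (leOfHom f)]
        exact ((Category.comp_id _).trans (Category.assoc ..)).symm }

end

section
variable {N : K} (p : ColimitPresentation α N)

/-- The morphism to the colimit of a diagram from the colimit of one of its restrictions. -/
noncomputable def subColimitToPt (A : Set α) : subColimit p.diag A ⟶ N :=
  subColimitDesc (fun x _ => p.ι.app x) fun _ _ _ _ h => p.w (homOfLE h)

@[simp]
theorem subColimitι_toPt {A : Set α} {x : α} (hx : x ∈ A) :
    subColimitι p.diag hx ≫ subColimitToPt p A = p.ι.app x :=
  subColimitι_desc ..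

@[simp]
theorem subColimitι_toPt_assoc {A : Set α} {x : α} (hx : x ∈ A) {Z : K} (f : N ⟶ Z) :
    subColimitι p.diag hx ≫ subColimitToPt p A ≫ f = p.ι.app x ≫ f := by
  rw [← Category.assoc, subColimitι_toPt]

/-- A colimit is the colimit of the colimits of its restrictions to the members of a directed cover
of the index preorder; `c x` is a member containing `x`. -/
noncomputable def presentationOfSubsets {G : Set (Set α)} (hG : DirectedOn (· ⊆ ·) G)
    {c : α → G} (hc : ∀ x, x ∈ (c x).1) : ColimitPresentation G N where
  diag := subColimitFunctor p.diag G
  ι :=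
    { app := fun A => subColimitToPt p A.1
      naturality := fun A B f => subColimit_hom_ext fun x hx => by
        simp [subColimitFunctor] }
  isColimit :=
    { desc := fun s => p.isColimit.desc (coconeOfSubsets hG hc s)
      fac := fun s A => subColimit_hom_ext fun x hx =>
        (subColimitι_toPt_assoc p hx _).trans
          ((p.isColimit.fac _ x).trans (subColimitι_comp_app_eq hG s (hc x) hx))
      uniq := fun s m hm => p.isColimit.hom_ext fun x =>
        ((subColimitι_toPt_assoc p (hc x) m).symm.trans
          (congrArg (subColimitι p.diag (hc x) ≫ ·) (hm (c x)))).trans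
          (p.isColimit.fac (coconeOfSubsets hG hc s) x).symm }

end

end

/-! ### The Löwenheim–Skolem property -/

theorem exists_small_closed_superset {α : Type u} {κ : Cardinal.{u}} [Fact κ.IsRegular]
    (hκ : Cardinal.aleph0 < κ) {F : α → α → Set α} (hF : ∀ x y, HasCardinalLT (F x y) κ)
    {A : Set α} (hA : HasCardinalLT A κ) :
    ∃ B : Set α, A ⊆ B ∧ HasCardinalLT B κ ∧ ∀ x ∈ B, ∀ y ∈ B, F x y ⊆ B := by
  let step (X : Set α) : Set α := X ∪ ⋃ p : X × X, F p.1 p.2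
  let X (n : ℕ) : Set α := step^[n] A
  have X_succ n : X (n + 1) = step (X n) := Function.iterate_succ_apply' _ _ _
  have hX : Monotone X := monotone_nat_of_le_succ fun n => by
    rw [X_succ]
    exact Set.subset_union_left
  have hasCardinalLT_X n : HasCardinalLT (X n) κ := by
    induction n with
    | zero => exact hA
    | succ n ih =>
      rw [X_succ]
      exact hasCardinalLT_union hκ.le ih
        (hasCardinalLT_iUnion _ (hasCardinalLT_prod' hκ.le ih ih) fun p => hF p.1 p.2)
  refine ⟨⋃ n, X n, Set.subset_iUnion X 0, hasCardinalLT_iUnion X ?_ hasCardinalLT_X, ?_⟩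
  · simpa [HasCardinalLT] using hκ
  · rintro x hx y hy z hz
    obtain ⟨n, hn⟩ := Set.mem_iUnion.1 hx
    obtain ⟨m, hm⟩ := Set.mem_iUnion.1 hy
    refine Set.mem_iUnion.2 ⟨max n m + 1, ?_⟩
    rw [X_succ]
    exact Or.inr (Set.mem_iUnion.2
      ⟨(⟨x, hX (le_max_left n m) hn⟩, ⟨y, hX (le_max_right n m) hm⟩), hz⟩)

theorem isCardinalFiltered_of_exists_superset {α : Type u} {κ : Cardinal.{u}} [Fact κ.IsRegular]
    {G : Set (Set α)} (hG : ∀ A ∈ G, HasCardinalLT A κ)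
    (hcof : ∀ A : Set α, HasCardinalLT A κ → ∃ B ∈ G, A ⊆ B) : IsCardinalFiltered G κ :=
  isCardinalFiltered_preorder _ _ fun I A hI => by
    obtain ⟨B, hB, hAB⟩ := hcof (⋃ i, (A i).1) (hasCardinalLT_iUnion _
      ((hasCardinalLT_iff_cardinal_mk_lt _ _).2 hI) fun i => hG _ (A i).2)
    exact ⟨⟨B, hB⟩, fun i => (Set.subset_iUnion (fun i => (A i).1) i).trans hAB⟩

section
variable {K : Type w} [Category.{u} K] {α : Type u}

attribute [local instance] Cardinal.fact_isRegular_aleph0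

theorem isCardinalPresentable_subColimit [Preorder α] [HasColimitsOfSize.{u, u} K] {D : α ⥤ K}
    {κ : Cardinal.{u}} [Fact κ.IsRegular] [∀ x, IsCardinalPresentable (D.obj x) κ] {A : Set α}
    (hA : HasCardinalLT A κ) : IsCardinalPresentable (subColimit D A) κ := by
  have (x : A) :
      IsCardinalPresentable (((Subtype.mono_coe (· ∈ A)).functor ⋙ D).obj x) κ :=
    inferInstanceAs (IsCardinalPresentable (D.obj x) κ)
  refine isCardinalPresentable_of_isColimit' _
    (colimit.isColimit ((Subtype.mono_coe (· ∈ A)).functor ⋙ D)) κ ?_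
  have hκ : Cardinal.aleph0 ≤ κ := (Fact.out : κ.IsRegular).aleph0_le
  refine (hasCardinalLT_prod hκ hA hA).of_injective
    (fun φ : Arrow A => (φ.left, φ.right)) fun φ ψ h => ?_
  obtain ⟨hl, hr⟩ := Prod.ext_iff.1 h
  exact Arrow.ext hl hr (Subsingleton.elim _ _)

section
variable [Preorder α] {N : K} (p : ColimitPresentation α N)

/-- A set of indices of a presentation of `N` is pure-closed if it is directed and every morphism
from one of its members to a finitely presentable object through which the structure morphism to `N`
factors divides a transition morphism to another of its members: the colimit of the restriction to
such a set is a pure subobject of `N`. -/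
structure IsPureClosed (A : Set α) : Prop where
  nonempty : A.Nonempty
  directedOn : DirectedOn (· ≤ ·) A
  exists_factorization : ∀ x ∈ A, ∀ ⦃Y : K⦄ [IsFinitelyPresentable.{u} Y]
    (q : p.diag.obj x ⟶ Y) (k : Y ⟶ N), q ≫ k = p.ι.app x →
      ∃ y ∈ A, ∃ (h : x ≤ y) (d : Y ⟶ p.diag.obj y), q ≫ d = p.diag.map (homOfLE h)

variable {p}

theorem IsPureClosed.isPure [HasColimitsOfSize.{u, u} K]
    [∀ x, IsFinitelyPresentable.{u} (p.diag.obj x)] {A : Set α} (hA : IsPureClosed p A) :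
    IsPure (subColimitToPt p A) := by
  intro X Y _ _ h g k hk
  obtain ⟨x, hx, g, rfl⟩ := exists_hom_subColimit p.diag hA.nonempty hA.directedOn g
  rw [Category.assoc, subColimitι_toPt] at hk
  have : IsFinitelyPresentable.{u} (pushout g h) :=
    isFinitelyPresentable_colimit _ (by rintro (_ | _ | _) <;> dsimp <;> infer_instance)
  obtain ⟨y, hy, hxy, d, hd⟩ := hA.exists_factorization x hx (pushout.inl g h)
    (pushout.desc (p.ι.app x) k hk) (pushout.inl_desc _ _ _)
  refine ⟨pushout.inr g h ≫ d ≫ subColimitι p.diag hy, ?_⟩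
  rw [← pushout.condition_assoc, reassoc_of% hd, subColimitι_w]

theorem exists_factorization_of_comp_eq [IsDirectedOrder α] [Nonempty α] {x : α}
    [IsFinitelyPresentable.{u} (p.diag.obj x)] {Y : K} [IsFinitelyPresentable.{u} Y]
    {q : p.diag.obj x ⟶ Y} {k : Y ⟶ N} (hk : q ≫ k = p.ι.app x) :
    ∃ (y : α) (h : x ≤ y) (d : Y ⟶ p.diag.obj y), q ≫ d = p.diag.map (homOfLE h) := by
  obtain ⟨y, d, rfl⟩ := IsFinitelyPresentable.exists_hom_of_isColimit p.isColimit k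
  obtain ⟨z, yz, xz, h⟩ := IsFinitelyPresentable.exists_eq_of_isColimit p.isColimit
    (q ≫ d) (𝟙 _) (by simpa using hk)
  exact ⟨z, leOfHom xz, d ≫ p.diag.map yz,
    (by simpa using h : q ≫ d ≫ p.diag.map yz = p.diag.map xz)⟩

theorem exists_isPureClosed_superset [IsDirectedOrder α] [Nonempty α] {κ : Cardinal.{u}}
    [Fact κ.IsRegular] (hκ : Cardinal.aleph0 < κ)
    (hp : ∀ x, IsFinitelyPresentable.{u} (p.diag.obj x)) {T : Type u} {S : T → K}
    (hS : ∀ t, IsFinitelyPresentable.{u} (S t))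
    (hS' : ∀ X : K, IsFinitelyPresentable.{u} X → ∃ t, Nonempty (X ≅ S t))
    (hSκ : ∀ t, HasCardinalLT (Σ t', (S t ⟶ S t')) κ) {A : Set α} (hA : HasCardinalLT A κ) :
    ∃ B : Set α, A ⊆ B ∧ HasCardinalLT B κ ∧ IsPureClosed p B := by
  have factor (x : α) (q : Σ t, (p.diag.obj x ⟶ S t)) : ∃ y, (∃ k, q.2 ≫ k = p.ι.app x) →
      ∃ (h : x ≤ y) (d : S q.1 ⟶ p.diag.obj y), q.2 ≫ d = p.diag.map (homOfLE h) := by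
    by_cases hk : ∃ k, q.2 ≫ k = p.ι.app x
    · obtain ⟨y, h⟩ := exists_factorization_of_comp_eq hk.choose_spec
      exact ⟨y, fun _ => h⟩
    · exact ⟨x, fun h => (hk h).elim⟩
  choose f hf using factor
  choose s hxs hys using fun x y : α => exists_ge_ge x y
  have hasCardinalLT_hom (x : α) : HasCardinalLT (Σ t, (p.diag.obj x ⟶ S t)) κ := by
    obtain ⟨t, ⟨e⟩⟩ := hS' _ (hp x)
    exact (hSκ t).of_surjective (fun q => ⟨q.1, e.hom ≫ q.2⟩)
      fun ⟨t', q⟩ => ⟨⟨t', e.inv ≫ q⟩, by simp⟩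
  have hasCardinalLT_singleton (x : α) : HasCardinalLT ({x} : Set α) κ :=
    hasCardinalLT_of_finite _ _ hκ.le
  obtain ⟨B, hAB, hBκ, hB⟩ := exists_small_closed_superset hκ
    (F := fun x y => {s x y} ∪ Set.range (f x))
    (fun x y => hasCardinalLT_union hκ.le (hasCardinalLT_singleton _)
      ((hasCardinalLT_hom x).of_surjective _ Set.rangeFactorization_surjective))
    (hasCardinalLT_union hκ.le hA (hasCardinalLT_singleton (Classical.arbitrary α)))
  refine ⟨B, Set.subset_union_left.trans hAB, hBκ, ⟨_, hAB (Or.inr rfl)⟩,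
    fun x hx y hy => ⟨s x y, hB x hx y hy (Or.inl rfl), hxs x y, hys x y⟩, ?_⟩
  intro x hx Y _ q k hk
  obtain ⟨t, ⟨e⟩⟩ := hS' Y ‹_›
  obtain ⟨h, d, hd⟩ := hf x ⟨t, q ≫ e.hom⟩ ⟨e.inv ≫ k, by simpa using hk⟩
  exact ⟨_, hB x hx x hx (Or.inr ⟨_, rfl⟩), h, e.hom ≫ d, by simpa using hd⟩

end

theorem exists_pure_presentation [IsLocallyFinitelyPresentable.{u} K] :
    ∃ (κ : Cardinal.{u}) (_ : Fact κ.IsRegular), Cardinal.aleph0 ≤ κ ∧ ∀ N : K,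
      ∃ (G : Type u) (_ : PartialOrder G) (_ : IsCardinalFiltered G κ)
        (p : ColimitPresentation G N),
        ∀ g, IsCardinalPresentable (p.diag.obj g) κ ∧ IsPure (p.ι.app g) := by
  obtain ⟨T, S, hS, hS'⟩ :=
    exists_small_family_of_essentiallySmall (ObjectProperty.isFinitelyPresentable.{u} K)
  obtain ⟨κ, hκ, hκ'⟩ := HasCardinalLT.exists_regular_cardinal_forall.{u}
    (fun o : Option T => o.elim (ULift.{u} ℕ) fun t => Σ t', (S t ⟶ S t'))
  have aleph0_lt : Cardinal.aleph0 < κ := by simpa [HasCardinalLT] using hκ' none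
  have : Fact κ.IsRegular := ⟨hκ⟩
  refine ⟨κ, this, aleph0_lt.le, fun N => ?_⟩
  obtain ⟨α, _, _, _, p, hp⟩ := exists_directed_presentation N
  have (x : α) : IsCardinalPresentable (p.diag.obj x) κ :=
    have : IsCardinalPresentable (p.diag.obj x) Cardinal.aleph0.{u} := hp x
    isCardinalPresentable_of_le _ aleph0_lt.le
  let G : Set (Set α) := {A | HasCardinalLT A κ ∧ IsPureClosed p A}
  have cofinal (A : Set α) (hA : HasCardinalLT A κ) : ∃ B ∈ G, A ⊆ B := by
    obtain ⟨B, hAB, hB⟩ := exists_isPureClosed_superset aleph0_lt hp hS hS'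
      (fun t => hκ' (some t)) hA
    exact ⟨B, hB, hAB⟩
  have directed : DirectedOn (· ⊆ ·) G := fun A hA B hB => by
    obtain ⟨C, hC, h⟩ := cofinal (A ∪ B) (hasCardinalLT_union aleph0_lt.le hA.1 hB.1)
    exact ⟨C, hC, Set.subset_union_left.trans h, Set.subset_union_right.trans h⟩
  choose c hcG hc using fun x : α => cofinal {x} (hasCardinalLT_of_finite _ _ aleph0_lt.le)
  exact ⟨G, inferInstance, isCardinalFiltered_of_exists_superset (fun A hA => hA.1) cofinal,
    presentationOfSubsets p directed (c := fun x => ⟨c x, hcG x⟩) fun x => hc x rfl,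
    fun A => ⟨isCardinalPresentable_subColimit A.2.1, A.2.2.isPure⟩⟩

end

/-! ### Limits and quotients of interpretations -/

section
variable {C : Type u₁} [Category.{v₁} C] {D : Type u₂} [Category.{v₂} D] {J : Type*} [Category* J]
  {K : Type*} [Category* K]

theorem preservesLimitsOfShape_of_isLimit [HasLimitsOfShape J D] {F : J ⥤ C ⥤ D} {c : Cone F}
    (hc : IsLimit c) (hF : ∀ j, PreservesLimitsOfShape K (F.obj j)) :
    PreservesLimitsOfShape K c.pt := by
  have : PreservesLimitsOfShape K F.flip := preservesLimitsOfShape_of_evaluation _ _ hF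
  exact preservesLimitsOfShape_of_natIso
    (hc.conePointUniqueUpToIso (limit.isLimit F) ≪≫ limitIsoFlipCompLim F).symm

theorem preservesColimitsOfShape_of_isColimit [HasColimitsOfShape J D] {F : J ⥤ C ⥤ D}
    {c : Cocone F} (hc : IsColimit c) (hF : ∀ j, PreservesColimitsOfShape K (F.obj j)) :
    PreservesColimitsOfShape K c.pt := by
  have : PreservesColimitsOfShape K F.flip := preservesColimitsOfShape_of_evaluation _ _ hF
  exact preservesColimitsOfShape_of_natIso
    (hc.coconePointUniqueUpToIso (colimit.isColimit F) ≪≫ colimitIsoFlipCompColim F).symm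

theorem existsUnique_map_π_eq {I : Type u} {F : C ⥤ Type u}
    [PreservesLimitsOfShape (Discrete I) F] {X : Discrete I ⥤ C} {c : Cone X} (hc : IsLimit c)
    (y : ∀ i, F.obj (X.obj i)) : ∃! x : F.obj c.pt, ∀ i, F.map (c.π.app i) x = y i :=
  (Types.isLimit_iff _).1 ⟨isLimitOfPreserves F hc⟩ y fun f => by
    obtain rfl := Discrete.ext (Discrete.eq_of_hom f)
    simp [Subsingleton.elim f (𝟙 _)]

end

theorem eq_iff_of_isColimit_cofork {X Y Z : Type u} {f g : X ⟶ Y}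
    (h : Equivalence (TypeCat.Rel.ofPair f g)) {π : Y ⟶ Z} {w : f ≫ π = g ≫ π}
    (hπ : IsColimit (Cofork.ofπ π w)) (x y : Y) : π x = π y ↔ TypeCat.Rel.ofPair f g x y := by
  refine ⟨fun hxy => ?_, ?_⟩
  · have hU := Types.coequalizer_preimage_image_eq_of_preimage_eq f g π w hπ
      {z | TypeCat.Rel.ofPair f g x z} <| Set.ext fun r =>
        ⟨fun hr => h.trans hr ⟨r, rfl, rfl⟩, fun hr => h.trans hr (h.symm ⟨r, rfl, rfl⟩)⟩
    exact hU.le ⟨x, h.refl x, hxy⟩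
  · rintro ⟨r, rfl, rfl⟩
    exact ConcreteCategory.congr_hom w r

section
variable {A : Type w} [Category.{u} A]

section
variable {F R : A ⥤ Type u}

theorem coequalizer_π_app_surjective (p q : R ⟶ F) (X : A) :
    Function.Surjective ((coequalizer.π p q).app X) :=
  (epi_iff_surjective _).1 inferInstance

theorem coequalizer_π_app_eq_iff {p q : R ⟶ F} {X : A}
    (h : Equivalence (TypeCat.Rel.ofPair (p.app X) (q.app X))) (x y : F.obj X) :
    (coequalizer.π p q).app X x = (coequalizer.π p q).app X y ↔
      TypeCat.Rel.ofPair (p.app X) (q.app X) x y :=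
  eq_iff_of_isColimit_cofork h (isColimitCoforkMapOfIsColimit ((evaluation A (Type u)).obj X)
    (coequalizer.condition p q) (coequalizerIsCoequalizer p q)) x y

end

namespace IsInterpretation

section
variable {F : A ⥤ Type u} (hF : IsInterpretation A F)
include hF

theorem existsUnique {J : Type u} {X : J → A} {c : Fan X} (hc : IsLimit c)
    (y : ∀ j, F.obj (X j)) : ∃! x : F.obj c.pt, ∀ j, F.map (c.proj j) x = y j := by
  have := hF.1 J
  obtain ⟨x, hx, hx'⟩ := existsUnique_map_π_eq (F := F) hc fun j => y j.as
  exact ⟨x, fun j => hx ⟨j⟩, fun x' h => hx' x' fun j => h j.as⟩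

variable {J : Type u} [PartialOrder J] [IsDirectedOrder J] [Nonempty J] {D : J ⥤ A}
  {c : Cocone D} (hc : IsColimit c)
include hc

theorem exists_rep (x : F.obj c.pt) : ∃ j, ∃ y : F.obj (D.obj j), F.map (c.ι.app j) y = x := by
  have := hF.2 J
  exact Types.jointly_surjective_of_isColimit (isColimitOfPreserves F hc) x

theorem exists_map_eq {j : J} {x y : F.obj (D.obj j)}
    (h : F.map (c.ι.app j) x = F.map (c.ι.app j) y) :
    ∃ (k : J) (f : j ⟶ k), F.map (D.map f) x = F.map (D.map f) y := by
  have := hF.2 J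
  exact (Types.FilteredColimit.isColimit_eq_iff' (isColimitOfPreserves F hc) x y).1 h

end

attribute [local instance] Cardinal.fact_isRegular_aleph0 in
theorem of_isLimit {J : Type} [SmallCategory J] [FinCategory J] {F : J ⥤ A ⥤ Type u} {c : Cone F}
    (hc : IsLimit c) (hF : ∀ j, IsInterpretation A (F.obj j)) : IsInterpretation A c.pt := by
  refine ⟨fun I => preservesLimitsOfShape_of_isLimit hc fun j => (hF j).1 I,
    fun I _ _ _ => ⟨⟨fun hd => ⟨?_⟩⟩⟩⟩
  have := (isCardinalFiltered_aleph0_iff.{u} I).2 inferInstance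
  exact Functor.Accessible.Limits.isColimitMapCocone c (fun _ => isLimitOfPreserves _ hc)
    Cardinal.aleph0.{u} (hasCardinalLT_of_finite _ _ le_rfl) _ fun j =>
      have := (hF j).2 I
      isColimitOfPreserves (F.obj j) hd

section
variable {F R : A ⥤ Type u} {p q : R ⟶ F}
  (h : ∀ X, Equivalence (TypeCat.Rel.ofPair (p.app X) (q.app X)))
include h

/- Representatives of the factors can be chosen componentwise; that two families of
representatives are related is witnessed componentwise in `R`, hence by an element of `R`. -/
theorem preservesLimitsOfShape_discrete_coequalizer {I : Type u}
    [PreservesLimitsOfShape (Discrete I) F] [PreservesLimitsOfShape (Discrete I) R] :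
    PreservesLimitsOfShape (Discrete I) (coequalizer p q) := by
  refine ⟨⟨fun {c} hc => ⟨((Types.isLimit_iff _).2 fun y _ => ?_).some⟩⟩⟩
  have naturality {H H' : A ⥤ Type u} (φ : H ⟶ H') i (x : H.obj c.pt) :
      H'.map (c.π.app i) (φ.app c.pt x) = φ.app _ (H.map (c.π.app i) x) :=
    (NatTrans.naturality_apply φ (c.π.app i) x).symm
  choose z hz using fun i => coequalizer_π_app_surjective p q _ (y i)
  obtain ⟨x, hx, -⟩ := existsUnique_map_π_eq (F := F) hc z
  refine ⟨(coequalizer.π p q).app _ x, fun i => ?_, fun y' hy' => ?_⟩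
  · exact (naturality _ i x).trans ((congrArg _ (hx i)).trans (hz i))
  · obtain ⟨x', rfl⟩ := coequalizer_π_app_surjective p q _ y'
    have related i : TypeCat.Rel.ofPair (p.app _) (q.app _) (F.map (c.π.app i) x') (z i) :=
      (coequalizer_π_app_eq_iff (h _) _ _).1
        ((naturality _ i x').symm.trans ((hy' i).trans (hz i).symm))
    choose r hpr hqr using related
    obtain ⟨r', hr', -⟩ := existsUnique_map_π_eq (F := R) hc r
    have lift_eq (s : R ⟶ F) (t : F.obj c.pt)
        (hs : ∀ i, s.app _ (r i) = F.map (c.π.app i) t) : s.app _ r' = t :=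
      (existsUnique_map_π_eq hc _).unique
        (fun i => (naturality s i r').trans ((congrArg _ (hr' i)).trans (hs i))) fun _ => rfl
    exact (coequalizer_π_app_eq_iff (h _) _ _).2
      ⟨r', lift_eq p x' hpr, lift_eq q x fun i => (hqr i).trans (hx i).symm⟩

theorem coequalizer (hF : IsInterpretation A F) (hR : IsInterpretation A R) :
    IsInterpretation A (coequalizer p q) := by
  refine ⟨fun I => ?_, fun I _ _ _ => ?_⟩
  · have := hF.1 I
    have := hR.1 I
    exact preservesLimitsOfShape_discrete_coequalizer h
  · refine preservesColimitsOfShape_of_isColimit (colimit.isColimit (parallelPair p q)) ?_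
    rintro (_ | _)
    exacts [hR.2 I, hF.2 I]

end

end IsInterpretation

end

/-! ### Exactness of `A⁺` -/

section
variable {C : Type u₁} [Category.{v₁} C] {D : Type u₂} [Category.{v₂} D]

theorem jointlyMono₂_map {R X Y : C} [HasBinaryProduct X Y] (F : C ⥤ D)
    [PreservesLimitsOfShape (Discrete WalkingPair) F] [PreservesLimitsOfShape WalkingCospan F]
    (p : R ⟶ X) (q : R ⟶ Y) [h : JointlyMono₂ p q] : JointlyMono₂ (F.map p) (F.map q) where
  right_cancellation Z f g hp hq := by
    have : Mono (prod.lift p q) :=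
      ⟨fun f g hfg => h.right_cancellation f g
        (by simpa only [Category.assoc, prod.lift_fst] using congrArg (· ≫ prod.fst) hfg)
        (by simpa only [Category.assoc, prod.lift_snd] using congrArg (· ≫ prod.snd) hfg)⟩
    rw [← cancel_mono (F.map (prod.lift p q))]
    refine BinaryFan.IsLimit.hom_ext (isLimitOfHasBinaryProductOfPreservesLimit F X Y) ?_ ?_
    · change (f ≫ F.map _) ≫ F.map prod.fst = (g ≫ F.map _) ≫ F.map prod.fst
      simpa only [Category.assoc, ← F.map_comp, prod.lift_fst] using hp
    · change (f ≫ F.map _) ≫ F.map prod.snd = (g ≫ F.map _) ≫ F.map prod.snd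
      simpa only [Category.assoc, ← F.map_comp, prod.lift_snd] using hq

theorem equivalence_map_of_isEquivalenceRelation {R X : C} [HasBinaryProduct X X] (F : C ⥤ Type u)
    [PreservesLimitsOfShape (Discrete WalkingPair) F] [PreservesLimitsOfShape WalkingCospan F]
    {p q : R ⟶ X} (h : IsEquivalenceRelation p q) :
    Equivalence (TypeCat.Rel.ofPair (F.map p) (F.map q)) := by
  obtain ⟨⟨e⟩⟩ := h
  have : JointlyMono₂ p q := ⟨e.right_cancellation⟩
  have := jointlyMono₂_map F p q
  exact TypeCat.equivalence_of_equivalenceRelation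
    { e.toReflexiveRelation.map F, e.toSymmetricRelation.map F, e.toTransitiveRelation.map F with }

theorem isKernelPair_of_eq_iff {R X Y : Type u} {p q : R ⟶ X} [h : JointlyMono₂ p q] {f : X ⟶ Y}
    (hf : ∀ x y, f x = f y ↔ TypeCat.Rel.ofPair p q x y) : IsKernelPair f p q := by
  refine (Types.isPullback_iff _ _ _ _).2 ⟨?_, fun r r' hr => ?_, fun x y => (hf x y).1⟩
  · ext r
    exact (hf _ _).2 ⟨r, rfl, rfl⟩
  · refine ConcreteCategory.congr_hom (h.right_cancellation (Y := PUnit) (↾fun _ => r)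
      (↾fun _ => r') ?_ ?_) ⟨⟩
    · ext
      exact hr.1
    · ext
      exact hr.2

end

section
variable {A : Type w} [Category.{u} A]

instance isClosedUnderLimitsOfShape_isInterpretation (J : Type) [SmallCategory J]
    [FinCategory J] : (IsInterpretation A).IsClosedUnderLimitsOfShape J where
  limitsOfShape_le := by
    rintro F ⟨h⟩
    exact IsInterpretation.of_isLimit h.isLimit h.prop_diag_obj

instance hasFiniteLimits_plus : HasFiniteLimits (Plus A) :=
  ⟨fun _ => inferInstance⟩

instance preservesFiniteLimits_plusι : PreservesFiniteLimits (IsInterpretation A).ι :=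
  ⟨fun _ => inferInstance⟩

namespace Plus

variable (A) in
/-- The evaluation functor `A⁺ ⥤ Set` at an object `X` of `A`. -/
abbrev eval (X : A) : Plus A ⥤ Type u := (IsInterpretation A).ι ⋙ (evaluation A (Type u)).obj X

theorem naturality {F G : Plus A} (f : F ⟶ G) {X Y : A} (h : X ⟶ Y) (x : F.obj.obj X) :
    f.hom.app Y (F.obj.map h x) = G.obj.map h (f.hom.app X x) :=
  NatTrans.naturality_apply f.hom h x

theorem hom_ext {F G : Plus A} {f g : F ⟶ G} (h : ∀ X x, f.hom.app X x = g.hom.app X x) :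
    f = g := by
  apply ObjectProperty.hom_ext
  ext X x
  exact h X x

theorem congr_app {F G : Plus A} {f g : F ⟶ G} (h : f = g) {X : A} (x : F.obj.obj X) :
    f.hom.app X x = g.hom.app X x := by
  rw [h]

theorem exists_of_isPullback {P F G H : Plus A} {p : P ⟶ F} {q : P ⟶ G} {f : F ⟶ H} {g : G ⟶ H}
    (h : IsPullback p q f g) {X : A} (x : F.obj.obj X) (y : G.obj.obj X)
    (hxy : f.hom.app X x = g.hom.app X y) : ∃ z, p.hom.app X z = x ∧ q.hom.app X z = y :=
  Types.exists_of_isPullback (h.map (eval A X)) x y hxy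

theorem isPullback_of_eval {P F G H : Plus A} {p : P ⟶ F} {q : P ⟶ G} {f : F ⟶ H} {g : G ⟶ H}
    (h : ∀ X, IsPullback ((eval A X).map p) ((eval A X).map q) ((eval A X).map f)
      ((eval A X).map g)) : IsPullback p q f g :=
  IsPullback.of_map (IsInterpretation A).ι (hom_ext fun X => ConcreteCategory.congr_hom (h X).w)
    (IsPullback.of_forall_isPullback_app h)

theorem app_eq_iff_of_isKernelPair {R F G : Plus A} {f : F ⟶ G} {p q : R ⟶ F}
    (h : IsKernelPair f p q) {X : A} (x y : F.obj.obj X) :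
    f.hom.app X x = f.hom.app X y ↔ TypeCat.Rel.ofPair (p.hom.app X) (q.hom.app X) x y := by
  refine ⟨exists_of_isPullback h x y, ?_⟩
  rintro ⟨r, rfl, rfl⟩
  exact congr_app h.w r

theorem exists_hom_of_existsUnique {F G : Plus A} (p : ∀ X, F.obj.obj X → G.obj.obj X → Prop)
    (h : ∀ X x, ∃! y, p X x y)
    (hp : ∀ {X Y : A} (f : X ⟶ Y) x y, p X x y → p Y (F.obj.map f x) (G.obj.map f y)) :
    ∃ f : F ⟶ G, ∀ X x, p X x (f.hom.app X x) := by
  choose f hf hf' using h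
  refine ⟨ObjectProperty.homMk
    { app := fun X => TypeCat.ofHom (f X)
      naturality := fun X Y g => ?_ }, hf⟩
  ext x
  exact (hf' _ _ _ (hp g _ _ (hf X x))).symm

section Surjective
variable {F G H : Plus A} {π : F ⟶ G} (hπ : ∀ X, Function.Surjective (π.hom.app X))
include hπ

theorem exists_desc (f : F ⟶ H)
    (hf : ∀ X x y, π.hom.app X x = π.hom.app X y → f.hom.app X x = f.hom.app X y) :
    ∃ d : G ⟶ H, π ≫ d = f := by
  obtain ⟨d, hd⟩ := exists_hom_of_existsUnique (F := G) (G := H)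
    (fun X y z => ∃ x, π.hom.app X x = y ∧ f.hom.app X x = z)
    (fun X y => by
      obtain ⟨x, rfl⟩ := hπ X y
      exact ⟨_, ⟨x, rfl, rfl⟩, fun z ⟨x', h, hz⟩ => hz.symm.trans (hf _ _ _ h)⟩)
    (by
      rintro X Y h _ _ ⟨x, rfl, rfl⟩
      exact ⟨F.obj.map h x, naturality .., naturality ..⟩)
  refine ⟨d, hom_ext fun X x => ?_⟩
  obtain ⟨x', h, hx'⟩ := hd X (π.hom.app X x)
  exact hx'.symm.trans (hf _ _ _ h)

theorem epi_of_surjective : Epi π where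
  left_cancellation f g h := hom_ext fun X y => by
    obtain ⟨x, rfl⟩ := hπ X y
    exact congr_app h x

theorem exists_isColimit_of_surjective {R : Plus A} {p q : R ⟶ F} (w : p ≫ π = q ≫ π)
    (h : ∀ X x y, π.hom.app X x = π.hom.app X y →
      TypeCat.Rel.ofPair (p.hom.app X) (q.hom.app X) x y) :
    Nonempty (IsColimit (Cofork.ofπ π w)) := by
  have exists_desc_cofork (s : Cofork p q) : ∃ d : G ⟶ s.pt, π ≫ d = s.π :=
    exists_desc hπ s.π fun X x y hxy => by
      obtain ⟨r, rfl, rfl⟩ := h X x y hxy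
      exact congr_app s.condition r
  have := epi_of_surjective hπ
  choose d hd using exists_desc_cofork
  exact ⟨Cofork.IsColimit.mk _ d hd fun s m hm => (cancel_epi π).1 (hm.trans (hd s).symm)⟩

theorem isRegularEpi_of_surjective : IsRegularEpi π := by
  obtain ⟨h⟩ := exists_isColimit_of_surjective hπ (pullback.condition (f := π) (g := π))
    fun X x y h => exists_of_isPullback (IsPullback.of_hasPullback π π) x y h
  exact ⟨⟨{ W := _, left := _, right := _, w := _, isColimit := h }⟩⟩

end Surjective

theorem exists_quotient {F R : Plus A} (p q : R ⟶ F)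
    (h : ∀ X, Equivalence (TypeCat.Rel.ofPair (p.hom.app X) (q.hom.app X))) :
    ∃ (G : Plus A) (π : F ⟶ G), (∀ X, Function.Surjective (π.hom.app X)) ∧
      ∀ X x y, π.hom.app X x = π.hom.app X y ↔
        TypeCat.Rel.ofPair (p.hom.app X) (q.hom.app X) x y :=
  ⟨⟨_, IsInterpretation.coequalizer h F.property R.property⟩,
    ObjectProperty.homMk (coequalizer.π p.hom q.hom), coequalizer_π_app_surjective p.hom q.hom,
    fun X => coequalizer_π_app_eq_iff (h X)⟩

theorem exists_quotient_of_isKernelPair {R F G : Plus A} {f : F ⟶ G} {p q : R ⟶ F}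
    (h : IsKernelPair f p q) :
    ∃ (I : Plus A) (π : F ⟶ I), (∀ X, Function.Surjective (π.hom.app X)) ∧
      ∀ X x y, π.hom.app X x = π.hom.app X y ↔ f.hom.app X x = f.hom.app X y := by
  obtain ⟨I, π, hπ, hπ'⟩ := exists_quotient p q fun X =>
    equivalence_map_of_isEquivalenceRelation (eval A X)
      (h.equivalenceRelation f p q (pullback.isLimit q p)).isEquivalenceRelation
  exact ⟨I, π, hπ, fun X x y => (hπ' X x y).trans (app_eq_iff_of_isKernelPair h x y).symm⟩

theorem surjective_of_isRegularEpi {F G : Plus A} (f : F ⟶ G) [IsRegularEpi f] (X : A) :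
    Function.Surjective (f.hom.app X) := by
  obtain ⟨I, π, hπ, hπf⟩ := exists_quotient_of_isKernelPair (IsKernelPair.of_hasPullback f)
  obtain ⟨m, rfl⟩ := exists_desc hπ f fun X x y => (hπf X x y).1
  have : Mono m := ⟨fun g g' hg => hom_ext fun Y z => by
    obtain ⟨x, hx⟩ := hπ Y (g.hom.app Y z)
    obtain ⟨x', hx'⟩ := hπ Y (g'.hom.app Y z)
    rw [← hx, ← hx', hπf]
    exact (congrArg _ hx).trans ((congr_app hg z).trans (congrArg _ hx').symm)⟩
  have := ExtremalEpi.isIso (π ≫ m) π m rfl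
  exact ((isIso_iff_bijective ((eval A X).map m)).1 inferInstance).surjective.comp (hπ X)

variable (A) in
theorem isExact : IsExact (Plus A) where
  regular :=
    { hasCoequalizer_of_isKernelPair := fun {F G R f p q} h => by
        obtain ⟨I, π, hπ, hπf⟩ := exists_quotient_of_isKernelPair h
        obtain ⟨hI⟩ := exists_isColimit_of_surjective hπ
          (hom_ext fun X r => (hπf X _ _).2 (congr_app h.w r)) fun X x y hxy =>
            (app_eq_iff_of_isKernelPair h x y).1 ((hπf X x y).1 hxy)
        exact ⟨⟨_, hI⟩⟩
      regularEpiIsStableUnderBaseChange := ⟨fun {X Y Y' S f g f' g'} h hg => by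
        have : IsRegularEpi g := hg
        refine isRegularEpi_of_surjective fun Z x => ?_
        obtain ⟨y, hy⟩ := surjective_of_isRegularEpi g Z (f.hom.app Z x)
        obtain ⟨z, -, hz⟩ := exists_of_isPullback h y x hy
        exact ⟨z, hz⟩⟩ }
  effective R F p q h := by
    obtain ⟨G, π, _, hπ⟩ := exists_quotient p q fun X =>
      equivalence_map_of_isEquivalenceRelation (eval A X) h
    obtain ⟨⟨e⟩⟩ := h
    have : JointlyMono₂ p q := ⟨e.right_cancellation⟩
    refine ⟨G, π, isPullback_of_eval fun X => ?_⟩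
    have := jointlyMono₂_map (eval A X) p q
    exact isKernelPair_of_eq_iff (p := (eval A X).map p) (q := (eval A X).map q) (hπ X)

end Plus

end

/-! ### Extension of natural transformations along a covering functor -/

section
variable {C : Type u₁} [Category.{v₁} C] {D : Type u₂} [Category.{v₂} D]

/-- A functor `Q : C ⥤ D` such that every object of `D` is a regular quotient of an object in the
image of `Q`, and every subobject of `Q.obj X` is covered by the image of a morphism to `X`. -/
structure IsCovering (Q : C ⥤ D) : Prop where
  exists_cover (F : D) : ∃ (X : C) (g : Q.obj X ⟶ F), IsRegularEpi g
  exists_cover_subobject {X : C} {W : D} (i : W ⟶ Q.obj X) [Mono i] :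
    ∃ (Z : C) (m : Z ⟶ X) (e : Q.obj Z ⟶ W), IsRegularEpi e ∧ e ≫ i = Q.map m

theorem IsRegularFunctor.epi_map {P : C ⥤ D} (hP : IsRegularFunctor P) ⦃X Y : C⦄ (f : X ⟶ Y)
    (hf : IsRegularEpi f) : Epi (P.map f) :=
  have := hP.regularEpi f hf
  inferInstance

namespace IsCovering

variable {Q : C ⥤ D}

section
variable [HasFiniteLimits C] [PreservesFiniteLimits Q] [HasFiniteLimits D]

theorem exists_cover_pullback (hQ : IsCovering Q) {X Y : C} {F : D} (g : Q.obj X ⟶ F)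
    (h : Q.obj Y ⟶ F) : ∃ (Z : C) (m : Z ⟶ X) (n : Z ⟶ Y) (e : Q.obj Z ⟶ pullback g h),
      IsRegularEpi e ∧ e ≫ pullback.fst g h = Q.map m ∧ e ≫ pullback.snd g h = Q.map n := by
  let i : pullback g h ⟶ Q.obj (X ⨯ Y) :=
    prod.lift (pullback.fst g h) (pullback.snd g h) ≫ inv (prodComparison Q X Y)
  have hi₁ : i ≫ Q.map prod.fst = pullback.fst g h := by
    rw [Category.assoc, inv_prodComparison_map_fst]
    exact prod.lift_fst _ _
  have hi₂ : i ≫ Q.map prod.snd = pullback.snd g h := by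
    rw [Category.assoc, inv_prodComparison_map_snd]
    exact prod.lift_snd _ _
  have : Mono i := ⟨fun s t hst => by
    refine pullback.hom_ext ?_ ?_
    · rw [← hi₁, reassoc_of% hst]
    · rw [← hi₂, reassoc_of% hst]⟩
  obtain ⟨Z, m, e, he, hem⟩ := hQ.exists_cover_subobject i
  refine ⟨Z, m ≫ prod.fst, m ≫ prod.snd, e, he, ?_, ?_⟩
  · rw [← hi₁, reassoc_of% hem, Q.map_comp]
  · rw [← hi₂, reassoc_of% hem, Q.map_comp]

variable {B : Type a} [Category.{b} B] {P₁ : D ⥤ B} {P₂ : D ⥤ B}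

theorem pullback_fst_app_eq_pullback_snd_app (hQ : IsCovering Q)
    (hP₁ : ∀ ⦃F G : D⦄ (g : F ⟶ G), IsRegularEpi g → Epi (P₁.map g)) (α : Q ⋙ P₁ ⟶ Q ⋙ P₂)
    {X Y : C} {F : D} (g : Q.obj X ⟶ F) (h : Q.obj Y ⟶ F) :
    P₁.map (pullback.fst g h) ≫ α.app X ≫ P₂.map g =
      P₁.map (pullback.snd g h) ≫ α.app Y ≫ P₂.map h := by
  have hα {X Y : C} (m : X ⟶ Y) : P₁.map (Q.map m) ≫ α.app Y = α.app X ≫ P₂.map (Q.map m) :=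
    α.naturality m
  obtain ⟨Z, m, n, e, he, hm, hn⟩ := hQ.exists_cover_pullback g h
  have := hP₁ e he
  rw [← cancel_epi (P₁.map e), ← P₁.map_comp_assoc, ← P₁.map_comp_assoc, hm, hn,
    reassoc_of% hα, reassoc_of% hα, ← P₂.map_comp, ← P₂.map_comp, ← hm, ← hn,
    Category.assoc, Category.assoc, pullback.condition]

theorem exists_map_comp_eq (hQ : IsCovering Q) (hP₁ : IsRegularFunctor P₁) (α : Q ⋙ P₁ ⟶ Q ⋙ P₂)
    {X : C} {F : D} (g : Q.obj X ⟶ F) [IsRegularEpi g] :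
    ∃ b : P₁.obj F ⟶ P₂.obj F, P₁.map g ≫ b = α.app X ≫ P₂.map g := by
  have := hP₁.lex
  have := hP₁.regularEpi g inferInstance
  have hp := (IsPullback.of_hasPullback g g).map P₁
  obtain ⟨b, hb⟩ := Cofork.IsColimit.desc' (IsRegularEpi.isColimit (P₁.map g))
    (α.app X ≫ P₂.map g) (by
      rw [← hp.lift_fst _ _ (IsRegularEpi.w (P₁.map g)), Category.assoc,
        hQ.pullback_fst_app_eq_pullback_snd_app hP₁.epi_map α g g, hp.lift_snd_assoc])
  exact ⟨b, hb⟩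

end

theorem existsUnique_whiskerLeft_eq [HasFiniteLimits C] [PreservesFiniteLimits Q] [Regular D]
    (hQ : IsCovering Q) {B : Type a} [Category.{b} B] {P₁ : D ⥤ B} (hP₁ : IsRegularFunctor P₁)
    (P₂ : D ⥤ B) (α : Q ⋙ P₁ ⟶ Q ⋙ P₂) : ∃! β : P₁ ⟶ P₂, Functor.whiskerLeft Q β = α := by
  choose X g hg using hQ.exists_cover
  choose b hb using fun F => hQ.exists_map_comp_eq hP₁ α (g F)
  have hb' {Y : C} {F : D} (h : Q.obj Y ⟶ F) : P₁.map h ≫ b F = α.app Y ≫ P₂.map h := by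
    have := hP₁.epi_map (pullback.fst h (g F)) inferInstance
    rw [← cancel_epi (P₁.map (pullback.fst h (g F))), ← P₁.map_comp_assoc, pullback.condition,
      P₁.map_comp_assoc, hb, hQ.pullback_fst_app_eq_pullback_snd_app hP₁.epi_map α]
  have hg' (F : D) : Epi (P₁.map (g F)) := hP₁.epi_map (g F) (hg F)
  refine ⟨{ app := b, naturality := fun F G k => ?_ }, ?_, fun β hβ => ?_⟩
  · rw [← cancel_epi (P₁.map (g F)), ← P₁.map_comp_assoc, hb', reassoc_of% hb, P₂.map_comp]
  · ext Y
    simpa using hb' (𝟙 (Q.obj Y))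
  · ext F
    rw [← cancel_epi (P₁.map (g F))]
    dsimp only
    rw [hb, ← hβ, β.naturality]
    rfl

end IsCovering

end

/-! ### Reduced products along a directed poset -/

section
variable {M : Type a} [Category.{u} M] {K : Type w} [Category.{u} K] {ι : M ⥤ K} {I : Type u}
  {U : I → M} [HasProduct U] [PreservesLimit (Discrete.functor U) ι] {C : K}

variable (ι) in
/-- The morphism to the image of a product given by morphisms to the images of its factors. -/
noncomputable def liftPi (b : ∀ i, C ⟶ ι.obj (U i)) : C ⟶ ι.obj (∏ᶜ U) :=
  (isLimitOfHasProductOfPreservesLimit ι U).lift (Fan.mk _ b)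

theorem liftPi_map_π (b : ∀ i, C ⟶ ι.obj (U i)) (i : I) : liftPi ι b ≫ ι.map (Pi.π U i) = b i :=
  (isLimitOfHasProductOfPreservesLimit ι U).fac _ ⟨i⟩

theorem hom_ext_map_π {f g : C ⟶ ι.obj (∏ᶜ U)}
    (h : ∀ i, f ≫ ι.map (Pi.π U i) = g ≫ ι.map (Pi.π U i)) : f = g :=
  (isLimitOfHasProductOfPreservesLimit ι U).hom_ext fun i => h i.as

end

section
variable {M : Type a} [Category.{u} M] [HasProducts.{u} M] {J : Type u} [PartialOrder J]

/-- The diagram of the products of the tails of a family; its colimit is the reduced product of the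
family modulo the filter of tails. -/
noncomputable def tailProd (U : J → M) : J ⥤ M where
  obj j := ∏ᶜ fun k : Set.Ici j => U k
  map {i j} f := Pi.lift fun k : Set.Ici j =>
    Pi.π (fun k : Set.Ici i => U k) ⟨k.1, (leOfHom f).trans k.2⟩

/-- The projections from the product of a tail. -/
noncomputable def tailProdπ (U : J → M) {j k : J} (h : j ≤ k) : (tailProd U).obj j ⟶ U k :=
  Pi.π (fun k : Set.Ici j => U k) ⟨k, h⟩

theorem tailProd_map_π (U : J → M) {i j k : J} (f : i ⟶ j) (h : j ≤ k) :
    (tailProd U).map f ≫ tailProdπ U h = tailProdπ U ((leOfHom f).trans h) :=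
  Pi.lift_π ..

/-- The morphism to the product of a tail given by its components. -/
noncomputable def tailProdLift {U : J → M} {j : J} {X : M} (f : ∀ k, j ≤ k → (X ⟶ U k)) :
    X ⟶ (tailProd U).obj j :=
  Pi.lift fun k : Set.Ici j => f k k.2

theorem tailProdLift_π {U : J → M} {j : J} {X : M} (f : ∀ k, j ≤ k → (X ⟶ U k)) {k : J}
    (h : j ≤ k) : tailProdLift f ≫ tailProdπ U h = f k h :=
  Pi.lift_π ..

theorem tailProd_ext {U : J → M} {j : J} {X : M} {f g : X ⟶ (tailProd U).obj j}
    (h : ∀ k (hk : j ≤ k), f ≫ tailProdπ U hk = g ≫ tailProdπ U hk) : f = g :=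
  Pi.hom_ext _ _ fun k => h k k.2

/-- The functoriality of `tailProd` in the family. -/
noncomputable def tailProdMap {U V : J → M} (h : ∀ j, U j ⟶ V j) : tailProd U ⟶ tailProd V where
  app j := tailProdLift fun k hk => tailProdπ U hk ≫ h k
  naturality i j f := tailProd_ext fun k hk => by
    rw [Category.assoc, Category.assoc, tailProdLift_π, tailProd_map_π, tailProdLift_π,
      ← Category.assoc, tailProd_map_π]

theorem tailProdMap_app_π {U V : J → M} (h : ∀ j, U j ⟶ V j) {j k : J} (hk : j ≤ k) :
    (tailProdMap h).app j ≫ tailProdπ V hk = tailProdπ U hk ≫ h k :=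
  tailProdLift_π (fun _ hk => tailProdπ U hk ≫ h _) hk

/-- The diagonal of a constant family. -/
noncomputable def tailProdDiag (V : M) (j : J) : V ⟶ (tailProd fun _ : J => V).obj j :=
  tailProdLift fun _ _ => 𝟙 V

theorem tailProdDiag_π (V : M) {j k : J} (h : j ≤ k) :
    tailProdDiag V j ≫ tailProdπ (fun _ => V) h = 𝟙 V :=
  tailProdLift_π _ h

theorem tailProdDiag_map (V : M) {i j : J} (f : i ⟶ j) :
    tailProdDiag V i ≫ (tailProd fun _ => V).map f = tailProdDiag V j :=
  tailProd_ext fun k hk => by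
    rw [Category.assoc, tailProd_map_π, tailProdDiag_π, tailProdDiag_π]

variable [HasColimitsOfShape J M]

/-- The structure morphisms of a reduced product. -/
noncomputable def reducedι (U : J → M) (j : J) : (tailProd U).obj j ⟶ colimit (tailProd U) :=
  colimit.ι (tailProd U) j

theorem tailProd_map_reducedι (U : J → M) {i j : J} (f : i ⟶ j) :
    (tailProd U).map f ≫ reducedι U j = reducedι U i :=
  colimit.w _ f

theorem reducedι_colimMap {U V : J → M} (h : ∀ j, U j ⟶ V j) (j : J) :
    reducedι U j ≫ colimMap (tailProdMap h) = (tailProdMap h).app j ≫ reducedι V j :=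
  ι_colimMap _ _

theorem tailProdDiag_reducedι [IsDirectedOrder J] (V : M) (i j : J) :
    tailProdDiag V i ≫ reducedι _ i = tailProdDiag V j ≫ reducedι _ j := by
  obtain ⟨k, hi, hj⟩ := exists_ge_ge i j
  rw [← tailProd_map_reducedι _ (homOfLE hi), ← tailProd_map_reducedι _ (homOfLE hj),
    ← Category.assoc, ← Category.assoc, tailProdDiag_map, tailProdDiag_map]

theorem exists_forall_eq_of_reduced [IsDirectedOrder J] [Nonempty J] {F : M ⥤ Type u}
    (hF : IsInterpretation M F) {U : J → M} {i : J} {y z : F.obj ((tailProd U).obj i)}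
    (h : F.map (reducedι U i) y = F.map (reducedι U i) z) :
    ∃ k, i ≤ k ∧ ∀ l (_ : k ≤ l) (hi : i ≤ l),
      F.map (tailProdπ U hi) y = F.map (tailProdπ U hi) z := by
  obtain ⟨k, f, hk⟩ := hF.exists_map_eq (colimit.isColimit (tailProd U)) h
  refine ⟨k, leOfHom f, fun l hl hi => ?_⟩
  rw [← tailProd_map_π U f hl, Functor.map_comp, comp_apply, comp_apply, hk]

end

section
variable {M : Type a} [Category.{u} M] [HasProducts.{u} M] {J : Type u} [PartialOrder J]
  {K : Type w} [Category.{u} K] {ι : M ⥤ K} [∀ I : Type u, PreservesLimitsOfShape (Discrete I) ι]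

section
variable {C : J ⥤ K} {U : J → M} (β : ∀ j, C.obj j ⟶ ι.obj (U j))

/-- The morphism to the product of a tail given by a family of morphisms. -/
noncomputable def toTailProd (j : J) : C.obj j ⟶ ι.obj ((tailProd U).obj j) :=
  liftPi ι fun k : Set.Ici j => C.map (homOfLE k.2) ≫ β k

theorem toTailProd_π {j k : J} (h : j ≤ k) :
    toTailProd β j ≫ ι.map (tailProdπ U h) = C.map (homOfLE h) ≫ β k :=
  liftPi_map_π _ (⟨k, h⟩ : Set.Ici j)

theorem tailProd_hom_ext {j : J} {X : K} {f g : X ⟶ ι.obj ((tailProd U).obj j)}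
    (h : ∀ k (hk : j ≤ k), f ≫ ι.map (tailProdπ U hk) = g ≫ ι.map (tailProdπ U hk)) : f = g :=
  hom_ext_map_π fun k => h k k.2

theorem toTailProd_naturality {i j : J} (f : i ⟶ j) :
    C.map f ≫ toTailProd β j = toTailProd β i ≫ ι.map ((tailProd U).map f) := by
  refine tailProd_hom_ext fun k hk => ?_
  rw [Category.assoc, Category.assoc, ← ι.map_comp, tailProd_map_π, toTailProd_π, toTailProd_π,
    ← C.map_comp_assoc]
  rfl

theorem toTailProd_tailProdMap {V : J → M} (h : ∀ j, U j ⟶ V j) (j : J) :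
    toTailProd β j ≫ ι.map ((tailProdMap h).app j) =
      toTailProd (fun j => β j ≫ ι.map (h j)) j := by
  refine tailProd_hom_ext fun k hk => ?_
  rw [Category.assoc, ← ι.map_comp, tailProdMap_app_π, ι.map_comp, ← Category.assoc, toTailProd_π,
    toTailProd_π, Category.assoc]

end

variable [HasColimitsOfShape J M] [ι.Full] {P : M} (p : ColimitPresentation J (ι.obj P))
  {U : J → M} (β : ∀ j, p.diag.obj j ⟶ ι.obj (U j))

/-- The morphism from a directed colimit to a reduced product given by a family of morphisms. -/
noncomputable def toReduced : P ⟶ colimit (tailProd U) :=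
  ι.preimage <| p.isColimit.desc
    { pt := ι.obj (colimit (tailProd U))
      ι :=
        { app := fun j => toTailProd β j ≫ ι.map (reducedι U j)
          naturality := fun i j f => by
            refine Eq.trans ?_ (Category.comp_id _).symm
            rw [← Category.assoc, toTailProd_naturality, Category.assoc, ← ι.map_comp,
              tailProd_map_reducedι] } }

theorem ι_toReduced (j : J) :
    p.ι.app j ≫ ι.map (toReduced p β) = toTailProd β j ≫ ι.map (reducedι U j) := by
  rw [toReduced, ι.map_preimage]
  exact p.isColimit.fac _ j

variable [ι.Faithful]

theorem toReduced_colimMap {V : J → M} (h : ∀ j, U j ⟶ V j) :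
    toReduced p β ≫ colimMap (tailProdMap h) = toReduced p fun j => β j ≫ ι.map (h j) := by
  refine ι.map_injective (p.isColimit.hom_ext fun j => ?_)
  change p.ι.app j ≫ _ = p.ι.app j ≫ _
  rw [ι_toReduced, ι.map_comp, reassoc_of% ι_toReduced, ← ι.map_comp, reducedι_colimMap,
    ι.map_comp, ← toTailProd_tailProdMap, Category.assoc]

theorem toReduced_const [IsDirectedOrder J] {V : M} (g : P ⟶ V) (i : J) :
    (toReduced p fun j => p.ι.app j ≫ ι.map g) = g ≫ tailProdDiag V i ≫ reducedι _ i := by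
  refine ι.map_injective (p.isColimit.hom_ext fun j => ?_)
  change p.ι.app j ≫ _ = p.ι.app j ≫ _
  rw [ι_toReduced, tailProdDiag_reducedι V i j, ← Category.assoc g, ι.map_comp, ← Category.assoc]
  refine congrArg (· ≫ _) (tailProd_hom_ext fun k hk => ?_)
  have hw : p.diag.map (homOfLE hk) ≫ p.ι.app k = p.ι.app j := p.w _
  rw [toTailProd_π, Category.assoc, ← ι.map_comp, Category.assoc, tailProdDiag_π,
    Category.comp_id, ← Category.assoc, hw]

variable {p β} {F : M ⥤ Type u} {x : F.obj P} {i : J} {y : F.obj ((tailProd U).obj i)}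

theorem map_reducedι_tailProdMap (hy : F.map (reducedι U i) y = F.map (toReduced p β) x)
    {V : J → M} (h : ∀ j, U j ⟶ V j) :
    F.map (reducedι V i) (F.map ((tailProdMap h).app i) y) =
      F.map (toReduced p fun j => β j ≫ ι.map (h j)) x := by
  rw [← comp_apply, ← Functor.map_comp, ← reducedι_colimMap, Functor.map_comp, comp_apply, hy,
    ← comp_apply, ← Functor.map_comp, toReduced_colimMap]

variable [IsDirectedOrder J] [Nonempty J] (hF : IsInterpretation M F)
include hF

theorem exists_forall_map_eq_map
    (hy : F.map (reducedι U i) y = F.map (toReduced p β) x) {V : J → M} {h g : ∀ j, U j ⟶ V j}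
    (hhg : ∀ j, β j ≫ ι.map (h j) = β j ≫ ι.map (g j)) :
    ∃ k, i ≤ k ∧ ∀ l (_ : k ≤ l) (hi : i ≤ l),
      F.map (tailProdπ U hi ≫ h l) y = F.map (tailProdπ U hi ≫ g l) y := by
  have hred := map_reducedι_tailProdMap hy h
  rw [funext hhg, ← map_reducedι_tailProdMap hy g] at hred
  obtain ⟨k, hk, hkl⟩ := exists_forall_eq_of_reduced hF hred
  refine ⟨k, hk, fun l hl hi => ?_⟩
  simpa only [← comp_apply, ← Functor.map_comp, tailProdMap_app_π] using hkl l hl hi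

theorem exists_forall_map_eq_map_of_families
    (hy : F.map (reducedι U i) y = F.map (toReduced p β) x) {I : J → Type u}
    {V : ∀ j, I j → M} {h g : ∀ j q, U j ⟶ V j q}
    (hhg : ∀ j q, β j ≫ ι.map (h j q) = β j ≫ ι.map (g j q)) :
    ∃ k, i ≤ k ∧ ∀ l (_ : k ≤ l) (hi : i ≤ l) q,
      F.map (tailProdπ U hi ≫ h l q) y = F.map (tailProdπ U hi ≫ g l q) y := by
  obtain ⟨k, hk, hkl⟩ := exists_forall_map_eq_map hF hy (V := fun j => ∏ᶜ V j)
    (h := fun j => Pi.lift (h j)) (g := fun j => Pi.lift (g j)) fun j => hom_ext_map_π fun q => by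
      rw [Category.assoc, Category.assoc, ← ι.map_comp, ← ι.map_comp, Pi.lift_π, Pi.lift_π, hhg]
  refine ⟨k, hk, fun l hl hi q => ?_⟩
  have hq := congrArg (F.map (Pi.π (V l) q)) (hkl l hl hi)
  rwa [← comp_apply, ← comp_apply, ← Functor.map_comp, ← Functor.map_comp, Category.assoc,
    Category.assoc, Pi.lift_π, Pi.lift_π] at hq

theorem exists_forall_map_eq (hy : F.map (reducedι U i) y = F.map (toReduced p β) x) {V : M}
    {h : ∀ j, U j ⟶ V} {g : P ⟶ V} (hhg : ∀ j, β j ≫ ι.map (h j) = p.ι.app j ≫ ι.map g) :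
    ∃ k, i ≤ k ∧ ∀ l (_ : k ≤ l) (hi : i ≤ l), F.map (tailProdπ U hi ≫ h l) y = F.map g x := by
  have hred := map_reducedι_tailProdMap hy h
  rw [funext hhg, toReduced_const p g i, ← Category.assoc, Functor.map_comp, comp_apply] at hred
  obtain ⟨k, hk, hkl⟩ := exists_forall_eq_of_reduced hF hred
  refine ⟨k, hk, fun l hl hi => ?_⟩
  simpa only [← comp_apply, ← Functor.map_comp, tailProdMap_app_π, Category.assoc,
    tailProdDiag_π, Category.comp_id] using hkl l hl hi

end

/-! ### Elements as morphisms from corepresented interpretations -/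

/-- A functor preserves small products and colimits of small directed diagrams. -/
class PreservesProductsAndDirectedColimits {K : Type w} [Category.{u} K] {M : Type a}
    [Category.{u} M] (ι : M ⥤ K) : Prop where
  products (I : Type u) : PreservesLimitsOfShape (Discrete I) ι
  directedColimits (I : Type u) [PartialOrder I] [IsDirectedOrder I] [Nonempty I] :
    PreservesColimitsOfShape I ι

attribute [instance] PreservesProductsAndDirectedColimits.products
  PreservesProductsAndDirectedColimits.directedColimits

section
variable {K : Type w} [Category.{u} K]

theorem isInterpretation_coyoneda (C : K) [IsFinitelyPresentable.{u} C] :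
    IsInterpretation K (coyoneda.obj (op C)) :=
  ⟨fun _ => inferInstance, fun _ _ _ _ => inferInstance⟩

/-- The interpretation corepresented by a finitely presentable object. -/
def corepr (C : K) [IsFinitelyPresentable.{u} C] : Plus K :=
  ⟨coyoneda.obj (op C), isInterpretation_coyoneda C⟩

/-- Precomposition, as a morphism of corepresented interpretations. -/
def coreprMap {C D : K} [IsFinitelyPresentable.{u} C] [IsFinitelyPresentable.{u} D] (f : C ⟶ D) :
    corepr D ⟶ corepr C :=
  ObjectProperty.homMk (coyoneda.map f.op)

/-- The morphism from a corepresented interpretation given by an element, by the Yoneda lemma. -/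
def coreprDesc {C : K} [IsFinitelyPresentable.{u} C] {X : Plus K} (z : X.obj.obj C) :
    corepr C ⟶ X :=
  ObjectProperty.homMk (coyonedaEquiv.symm z)

variable {M : Type a} [Category.{u} M] (ι : M ⥤ K) [PreservesProductsAndDirectedColimits ι]

theorem IsInterpretation.comp {F : K ⥤ Type u} (hF : IsInterpretation K F) :
    IsInterpretation M (ι ⋙ F) :=
  ⟨fun J => have := hF.1 J; inferInstance, fun J _ _ _ => have := hF.2 J; inferInstance⟩

/-- The functor `K⁺ ⥤ M⁺` given by precomposition with a functor `M ⥤ K`. -/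
def precomp : Plus K ⥤ Plus M :=
  (IsInterpretation M).lift ((IsInterpretation K).ι ⋙ (Functor.whiskeringLeft _ _ _).obj ι)
    fun F => F.property.comp ι

variable {C : K} [IsFinitelyPresentable.{u} C] {N : M}

/-- A morphism `C ⟶ ι.obj N` as an element of the interpretation corepresented by `C`. -/
def coreprElem (b : C ⟶ ι.obj N) : ((precomp ι).obj (corepr C)).obj.obj N := b

theorem exists_coreprElem_eq (y : ((precomp ι).obj (corepr C)).obj.obj N) :
    ∃ b : C ⟶ ι.obj N, coreprElem ι b = y :=
  ⟨y, rfl⟩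

theorem coreprElem_injective : Function.Injective (coreprElem ι : (C ⟶ ι.obj N) → _) :=
  Function.injective_id

theorem map_coreprElem (b : C ⟶ ι.obj N) {N' : M} (h : N ⟶ N') :
    ((precomp ι).obj (corepr C)).obj.map h (coreprElem ι b) = coreprElem ι (b ≫ ι.map h) :=
  rfl

theorem coreprDesc_app {X : Plus K} (z : X.obj.obj C) (b : C ⟶ ι.obj N) :
    ((precomp ι).map (coreprDesc z)).hom.app N (coreprElem ι b) = X.obj.map b z :=
  rfl

theorem coreprMap_comp_app {D : K} [IsFinitelyPresentable.{u} D] {F : Plus M} (f : C ⟶ D)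
    (ν : (precomp ι).obj (corepr C) ⟶ F) (b : D ⟶ ι.obj N) :
    ((precomp ι).map (coreprMap f) ≫ ν).hom.app N (coreprElem ι b) =
      ν.hom.app N (coreprElem ι (f ≫ b)) :=
  rfl

theorem app_coreprElem_comp {F : Plus M} (ν : (precomp ι).obj (corepr C) ⟶ F) (b : C ⟶ ι.obj N)
    {N' : M} (h : N ⟶ N') :
    ν.hom.app N' (coreprElem ι (b ≫ ι.map h)) = F.obj.map h (ν.hom.app N (coreprElem ι b)) :=
  Plus.naturality ν h (coreprElem ι b)

theorem surjective_of_app_coreprElem_eq {F : Plus M} {x : F.obj.obj N}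
    (hx : ∀ (X : M) (y : F.obj.obj X), ∃ f : N ⟶ X, F.obj.map f x = y)
    (ν : (precomp ι).obj (corepr C) ⟶ F) {b : C ⟶ ι.obj N}
    (hν : ν.hom.app N (coreprElem ι b) = x) (X : M) : Function.Surjective (ν.hom.app X) := by
  intro y
  obtain ⟨f, rfl⟩ := hx X y
  exact ⟨coreprElem ι (b ≫ ι.map f), by rw [app_coreprElem_comp, hν]⟩

end

section
variable {K : Type w} [Category.{u} K] {M : Type a} [Category.{u} M] [HasProducts.{u} M]
  {ι : M ⥤ K} [PreservesProductsAndDirectedColimits ι]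

section
variable {T : Type u}

variable (ι) in
/-- The product of a family of objects over all morphisms from `C` to their images. -/
noncomputable def homProd (N : T → M) (C : K) : M :=
  ∏ᶜ fun q : Σ t, (C ⟶ ι.obj (N t)) => N q.1

variable (ι) in
/-- The projections from `homProd`. -/
noncomputable def homProdπ (N : T → M) {C : K} (t : T) (b : C ⟶ ι.obj (N t)) :
    homProd ι N C ⟶ N t :=
  Pi.π (fun q : Σ t, (C ⟶ ι.obj (N t)) => N q.1) ⟨t, b⟩

variable (ι) in
/-- The canonical morphism to the image of `homProd`. -/
noncomputable def toHomProd (N : T → M) (C : K) : C ⟶ ι.obj (homProd ι N C) :=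
  liftPi ι fun q : Σ t, (C ⟶ ι.obj (N t)) => q.2

theorem toHomProd_π (N : T → M) {C : K} (t : T) (b : C ⟶ ι.obj (N t)) :
    toHomProd ι N C ≫ ι.map (homProdπ ι N t b) = b :=
  liftPi_map_π _ (⟨t, b⟩ : Σ t, (C ⟶ ι.obj (N t)))

end

variable [ι.Full] {J : Type u} [PartialOrder J] [IsDirectedOrder J] [Nonempty J]
  [HasColimitsOfShape J M] {P : M} (p : ColimitPresentation J (ι.obj P))

/- If the two morphisms differed at every later stage `k`, witnesses `p.diag.obj k ⟶ ι.obj (U k)` of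
this would give a morphism from `P` to the reduced product of the `U k` separating them. -/
theorem exists_coreprMap_comp_eq [∀ j, IsFinitelyPresentable.{u} (p.diag.obj j)] {F : Plus M}
    {i : J} (ν ν' : (precomp ι).obj (corepr (p.diag.obj i)) ⟶ F)
    (h : ν.hom.app P (coreprElem ι (p.ι.app i)) = ν'.hom.app P (coreprElem ι (p.ι.app i))) :
    ∃ (k : J) (f : i ⟶ k), (precomp ι).map (coreprMap (p.diag.map f)) ≫ ν =
      (precomp ι).map (coreprMap (p.diag.map f)) ≫ ν' := by
  by_contra! hne
  have hU (k : J) : ∃ (X : M) (b : p.diag.obj k ⟶ ι.obj X), ∀ f : i ⟶ k,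
      ν.hom.app X (coreprElem ι (p.diag.map f ≫ b)) ≠
        ν'.hom.app X (coreprElem ι (p.diag.map f ≫ b)) := by
    by_cases hk : Nonempty (i ⟶ k)
    · obtain ⟨f⟩ := hk
      by_contra! hk
      refine hne k f (Plus.hom_ext fun X y => ?_)
      obtain ⟨b, rfl⟩ := exists_coreprElem_eq ι y
      obtain ⟨f', hf'⟩ := hk X b
      obtain rfl : f = f' := Subsingleton.elim _ _
      exact hf'
    · exact ⟨P, p.ι.app k, fun f => (hk ⟨f⟩).elim⟩
  choose U β hβ using hU
  have hmap (η : (precomp ι).obj (corepr (p.diag.obj i)) ⟶ F) :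
      F.obj.map (reducedι U i) (η.hom.app _ (coreprElem ι (toTailProd β i))) =
        F.obj.map (toReduced p β) (η.hom.app P (coreprElem ι (p.ι.app i))) := by
    rw [← app_coreprElem_comp, ← app_coreprElem_comp, ι_toReduced]
  obtain ⟨k, hk, hkl⟩ := exists_forall_eq_of_reduced F.property
    ((hmap ν).trans ((congrArg _ h).trans (hmap ν').symm))
  have hk' := hkl k le_rfl hk
  rw [← app_coreprElem_comp, ← app_coreprElem_comp, toTailProd_π] at hk'
  exact hβ k (homOfLE hk) hk'

/- The germ of the image of `x` in the reduced product of the objects `homProd ι N (p.diag.obj j)`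
is natural at a sufficiently late stage. -/
theorem exists_natural_on_family [ι.Faithful] {F : M ⥤ Type u} (hF : IsInterpretation M F)
    (x : F.obj P) {T : Type u} (N : T → M) {t₀ : T} (g : P ⟶ N t₀) :
    ∃ (i : J) (v : ∀ t, (p.diag.obj i ⟶ ι.obj (N t)) → F.obj (N t)),
      (∀ s t (h : N s ⟶ N t) b, v t (b ≫ ι.map h) = F.map h (v s b)) ∧
      v t₀ (p.ι.app i ≫ ι.map g) = F.map g x := by
  let β (j : J) := toHomProd ι N (p.diag.obj j)
  obtain ⟨i, y, hy⟩ := hF.exists_rep (colimit.isColimit (tailProd _)) (F.map (toReduced p β) x)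
  obtain ⟨k₀, hk₀, h₀⟩ := exists_forall_map_eq hF hy
    (h := fun j => homProdπ ι N t₀ (p.ι.app j ≫ ι.map g)) fun j => toHomProd_π N t₀ _
  obtain ⟨k₁, _, h₁⟩ := exists_forall_map_eq_map_of_families hF hy
    (V := fun _ q => N q.2.1)
    (I := fun j => Σ (s : T) (t : T), (N s ⟶ N t) × (p.diag.obj j ⟶ ι.obj (N s)))
    (h := fun _ q => homProdπ ι N q.2.1 (q.2.2.2 ≫ ι.map q.2.2.1))
    (g := fun _ q => homProdπ ι N q.1 q.2.2.2 ≫ q.2.2.1)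
    fun j q => by rw [toHomProd_π, ι.map_comp, ← Category.assoc, toHomProd_π]
  obtain ⟨l, hl₀, hl₁⟩ := exists_ge_ge k₀ k₁
  have hi : i ≤ l := hk₀.trans hl₀
  refine ⟨l, fun t b => F.map (tailProdπ _ hi ≫ homProdπ ι N t b) y, fun s t h b => ?_, h₀ l hl₀ hi⟩
  rw [← comp_apply, ← Functor.map_comp, Category.assoc]
  exact h₁ l hl₁ hi ⟨s, t, h, b⟩

end

/-! ### Test families -/

theorem essentiallySmall_of_exists_code {C : Type u₁} [Category.{v₁} C] [LocallySmall.{u} C]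
    {S : Type u} (p : S → C → Prop) (hp : ∀ X, ∃ s, p s X)
    (h : ∀ s X Y, p s X → p s Y → Nonempty (X ≅ Y)) : EssentiallySmall.{u} C := by
  refine (essentiallySmall_iff _).2 ⟨?_, inferInstance⟩
  choose code hcode using hp
  refine small_of_injective (f := fun X : Skeleton C => code ((fromSkeleton C).obj X))
    fun X Y hXY => ?_
  have hY : p (code ((fromSkeleton C).obj X)) ((fromSkeleton C).obj Y) := by
    change code _ = code _ at hXY
    rw [hXY]
    exact hcode _
  obtain ⟨e⟩ := h _ _ _ (hcode _) hY
  exact skeleton_skeletal _ ⟨(fromSkeleton C).preimageIso e⟩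

section
variable {K : Type w} [Category.{u} K] {M : Type a} [Category.{u} M]

/-- A small family of objects that determines the interpretations of `M`: every element comes from
an object of the family, and two morphisms from objects of the family factor through a common
morphism from a third one that `ι` sends to a monomorphism. -/
structure IsTestFamily (ι : M ⥤ K) {T : Type u} (N : T → M) : Prop where
  exists_elem {F : M ⥤ Type u} (hF : IsInterpretation M F) {X : M} (x : F.obj X) :
    ∃ (t : T) (g : N t ⟶ X) (y : F.obj (N t)), F.map g y = x
  exists_mono {X : M} {s t : T} (f : N s ⟶ X) (g : N t ⟶ X) :
    ∃ (r : T) (i : N r ⟶ X) (f' : N s ⟶ N r) (g' : N t ⟶ N r),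
      Mono (ι.map i) ∧ f' ≫ i = f ∧ g' ≫ i = g

namespace IsTestFamily

variable {ι : M ⥤ K} {T : Type u} {N : T → M} (hN : IsTestFamily ι N)
include hN

theorem exists_coreprElem_map_eq [PreservesProductsAndDirectedColimits ι] {C : K}
    [IsFinitelyPresentable.{u} C] {X : M} (y : ((precomp ι).obj (corepr C)).obj.obj X) :
    ∃ (t : T) (g : N t ⟶ X) (b : C ⟶ ι.obj (N t)), coreprElem ι (b ≫ ι.map g) = y :=
  hN.exists_elem ((precomp ι).obj (corepr C)).property y

theorem exists_generic [HasProducts.{u} M] (F : Plus M) :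
    ∃ (P : M) (x : F.obj.obj P), ∀ (X : M) (y : F.obj.obj X), ∃ f : P ⟶ X, F.obj.map f x = y := by
  let U (q : Σ t, F.obj.obj (N t)) : M := N q.1
  obtain ⟨x, hx, -⟩ := F.property.existsUnique (productIsProduct U) fun q => q.2
  refine ⟨∏ᶜ U, x, fun X y => ?_⟩
  obtain ⟨t, g, z, rfl⟩ := hN.exists_elem F.property y
  refine ⟨Pi.π U ⟨t, z⟩ ≫ g, ?_⟩
  rw [Functor.map_comp]
  exact congrArg (F.obj.map g) (hx ⟨t, z⟩)

theorem exists_hom_of_natural [PreservesProductsAndDirectedColimits ι] {C : K}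
    [IsFinitelyPresentable.{u} C] (F : Plus M) (v : ∀ t, (C ⟶ ι.obj (N t)) → F.obj.obj (N t))
    (hv : ∀ s t (h : N s ⟶ N t) b, v t (b ≫ ι.map h) = F.obj.map h (v s b)) :
    ∃ ν : (precomp ι).obj (corepr C) ⟶ F, ∀ t b, ν.hom.app (N t) (coreprElem ι b) = v t b := by
  have huniq {X : M} {s t : T} (f : N s ⟶ X) (g : N t ⟶ X) (b : C ⟶ ι.obj (N s))
      (c : C ⟶ ι.obj (N t)) (h : b ≫ ι.map f = c ≫ ι.map g) :
      F.obj.map f (v s b) = F.obj.map g (v t c) := by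
    obtain ⟨r, i, f', g', hi, rfl, rfl⟩ := hN.exists_mono f g
    have hbc : b ≫ ι.map f' = c ≫ ι.map g' := by
      rw [← cancel_mono (ι.map i), Category.assoc, Category.assoc, ← ι.map_comp, ← ι.map_comp, h]
    rw [Functor.map_comp, Functor.map_comp, comp_apply, comp_apply, ← hv, ← hv, hbc]
  obtain ⟨ν, hν⟩ := Plus.exists_hom_of_existsUnique (F := (precomp ι).obj (corepr C)) (G := F)
    (fun X y z => ∃ (t : T) (g : N t ⟶ X) (b : C ⟶ ι.obj (N t)),
      coreprElem ι (b ≫ ι.map g) = y ∧ F.obj.map g (v t b) = z)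
    (fun X y => by
      obtain ⟨t, g, b, rfl⟩ := hN.exists_coreprElem_map_eq y
      refine ⟨_, ⟨t, g, b, rfl, rfl⟩, ?_⟩
      rintro _ ⟨s, f, c, h, rfl⟩
      exact huniq f g c b (coreprElem_injective ι h))
    (by
      rintro X Y f _ _ ⟨t, g, b, rfl, rfl⟩
      exact ⟨t, g ≫ f, b, by rw [map_coreprElem, ι.map_comp, Category.assoc],
        by rw [Functor.map_comp, comp_apply]⟩)
  refine ⟨ν, fun t b => ?_⟩
  obtain ⟨s, g, c, hc, h⟩ := hν (N t) (coreprElem ι b)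
  rw [← h, huniq g (𝟙 _) c b (by rw [ι.map_id, Category.comp_id, coreprElem_injective ι hc]),
    F.obj.map_id, id_apply]

theorem locallySmall : LocallySmall.{u} (Plus M) where
  hom_small F G := by
    refine small_of_injective (β := ∀ t, F.obj.obj (N t) → G.obj.obj (N t))
      (f := fun φ t x => φ.hom.app (N t) x) fun φ ψ h => Plus.hom_ext fun X x => ?_
    obtain ⟨t, g, y, rfl⟩ := hN.exists_elem F.property x
    rw [Plus.naturality, Plus.naturality]
    exact congrArg (G.obj.map g) (congrFun (congrFun h t) y)

theorem exists_desc {R F G : Plus M} {ν : R ⟶ F} {μ : R ⟶ G}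
    (hν : ∀ X, Function.Surjective (ν.hom.app X))
    (h : ∀ t x y, ν.hom.app (N t) x = ν.hom.app (N t) y → μ.hom.app (N t) x = μ.hom.app (N t) y) :
    ∃ d : F ⟶ G, ν ≫ d = μ := by
  refine Plus.exists_desc hν μ fun X x y hxy => ?_
  obtain ⟨r, rfl, rfl⟩ := Plus.exists_of_isPullback (IsPullback.of_hasPullback ν ν) x y hxy
  obtain ⟨t, g, r, rfl⟩ := hN.exists_elem (pullback ν ν).property r
  simp only [Plus.naturality]
  exact congrArg (G.obj.map g) (h t _ _ (Plus.congr_app pullback.condition r))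

theorem nonempty_iso {R F G : Plus M} {ν : R ⟶ F} {μ : R ⟶ G}
    (hν : ∀ X, Function.Surjective (ν.hom.app X)) (hμ : ∀ X, Function.Surjective (μ.hom.app X))
    (h : ∀ t x y, ν.hom.app (N t) x = ν.hom.app (N t) y ↔ μ.hom.app (N t) x = μ.hom.app (N t) y) :
    Nonempty (F ≅ G) := by
  obtain ⟨d, hd⟩ := hN.exists_desc hν fun t x y => (h t x y).1
  obtain ⟨d', hd'⟩ := hN.exists_desc hμ fun t x y => (h t x y).2
  have := Plus.epi_of_surjective hν
  have := Plus.epi_of_surjective hμ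
  exact ⟨⟨d, d', by rw [← cancel_epi ν, reassoc_of% hd, hd', Category.comp_id],
    by rw [← cancel_epi μ, reassoc_of% hd', hd, Category.comp_id]⟩⟩

theorem essentiallySmall_of_exists_surjective {S : Type u} (R : S → Plus M)
    (hR : ∀ F : Plus M, ∃ (s : S) (ν : R s ⟶ F), ∀ X, Function.Surjective (ν.hom.app X)) :
    EssentiallySmall.{u} (Plus M) := by
  have := hN.locallySmall
  -- An interpretation is determined by a cover `R s` and the kernel of the cover at the family.
  refine essentiallySmall_of_exists_code
    (S := Σ s, ∀ t, (R s).obj.obj (N t) → (R s).obj.obj (N t) → Prop)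
    (fun c F => ∃ ν : R c.1 ⟶ F, (∀ X, Function.Surjective (ν.hom.app X)) ∧
      ∀ t x y, c.2 t x y ↔ ν.hom.app (N t) x = ν.hom.app (N t) y)
    (fun F => ?_) ?_
  · obtain ⟨s, ν, hν⟩ := hR F
    exact ⟨⟨s, fun t x y => ν.hom.app (N t) x = ν.hom.app (N t) y⟩, ν, hν, fun _ _ _ => Iff.rfl⟩
  · rintro c F G ⟨ν, hν, h⟩ ⟨μ, hμ, h'⟩
    exact hN.nonempty_iso hν hμ fun t x y => (h t x y).symm.trans (h' t x y)

end IsTestFamily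

end

/-! ### Covers by corepresented interpretations -/

/-- A category has colimits of small directed diagrams. -/
class HasDirectedColimits (M : Type a) [Category.{u} M] : Prop where
  hasColimitsOfShape (I : Type u) [PartialOrder I] [IsDirectedOrder I] [Nonempty I] :
    HasColimitsOfShape I M

attribute [instance] HasDirectedColimits.hasColimitsOfShape

theorem coreprMap_comp_coreprDesc {K : Type w} [Category.{u} K] {C D : K}
    [IsFinitelyPresentable.{u} C] [IsFinitelyPresentable.{u} D] {X : Plus K} (f : C ⟶ D)
    (z : X.obj.obj C) : coreprMap f ≫ coreprDesc z = coreprDesc (X.obj.map f z) :=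
  ObjectProperty.hom_ext _ (coyonedaEquiv_symm_map f z).symm

namespace IsTestFamily

variable {K : Type w} [Category.{u} K] {M : Type a} [Category.{u} M] [HasProducts.{u} M]
  {ι : M ⥤ K} [PreservesProductsAndDirectedColimits ι] [ι.Full] [ι.Faithful]
  {T : Type u} {N : T → M} (hN : IsTestFamily ι N)
include hN

theorem exists_app_coreprElem_eq {J : Type u} [PartialOrder J] [IsDirectedOrder J] [Nonempty J]
    [HasColimitsOfShape J M] {P : M} (p : ColimitPresentation J (ι.obj P))
    [∀ j, IsFinitelyPresentable.{u} (p.diag.obj j)] (F : Plus M) (x : F.obj.obj P) :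
    ∃ (i : J) (ν : (precomp ι).obj (corepr (p.diag.obj i)) ⟶ F),
      ν.hom.app P (coreprElem ι (p.ι.app i)) = x := by
  obtain ⟨i, v, hv, hx⟩ := exists_natural_on_family p F.property x
    (fun o : Option T => o.elim P N) (t₀ := none) (𝟙 P)
  obtain ⟨ν, hν⟩ := hN.exists_hom_of_natural F (fun t => v (some t))
    fun s t => hv (some s) (some t)
  refine ⟨i, ν, ?_⟩
  obtain ⟨t, g, b, hb⟩ := hN.exists_coreprElem_map_eq (coreprElem ι (p.ι.app i))
  have hb' : b ≫ ι.map g = p.ι.app i ≫ ι.map (𝟙 P) := by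
    rw [ι.map_id]
    exact (coreprElem_injective ι hb).trans (Category.comp_id _).symm
  have hx' : v none (b ≫ ι.map g) = x :=
    (congrArg (v none) hb').trans (hx.trans (F.obj.map_id_apply P x))
  rw [← hb, app_coreprElem_comp, hν]
  exact (hv (some t) none g b).symm.trans hx'

variable [IsLocallyFinitelyPresentable.{u} K] [HasDirectedColimits M]

theorem exists_surjective (F : Plus M) :
    ∃ (C : K) (_ : IsFinitelyPresentable.{u} C) (ν : (precomp ι).obj (corepr C) ⟶ F),
      ∀ X, Function.Surjective (ν.hom.app X) := by
  obtain ⟨P, x, hx⟩ := hN.exists_generic F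
  obtain ⟨J, _, _, _, p, hp⟩ := exists_directed_presentation (ι.obj P)
  obtain ⟨i, ν, hν⟩ := hN.exists_app_coreprElem_eq p F x
  exact ⟨_, hp i, ν, surjective_of_app_coreprElem_eq ι hx ν hν⟩

theorem exists_surjective_comp_eq {X : Plus K} {W : Plus M} (j : W ⟶ (precomp ι).obj X) :
    ∃ (C : K) (_ : IsFinitelyPresentable.{u} C) (z : X.obj.obj C)
      (e : (precomp ι).obj (corepr C) ⟶ W),
      (∀ Y, Function.Surjective (e.hom.app Y)) ∧ e ≫ j = (precomp ι).map (coreprDesc z) := by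
  obtain ⟨P, x, hx⟩ := hN.exists_generic W
  obtain ⟨J, _, _, _, p, hp⟩ := exists_directed_presentation (ι.obj P)
  obtain ⟨i₁, ν, hν⟩ := hN.exists_app_coreprElem_eq p W x
  obtain ⟨i₂, z, hz⟩ := X.property.exists_rep p.isColimit (j.hom.app P x)
  obtain ⟨k, hk₁, hk₂⟩ := exists_ge_ge i₁ i₂
  let ν' := (precomp ι).map (coreprMap (p.diag.map (homOfLE hk₁))) ≫ ν
  let z' := X.obj.map (p.diag.map (homOfLE hk₂)) z
  have hν' : ν'.hom.app P (coreprElem ι (p.ι.app k)) = x := by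
    rw [coreprMap_comp_app, p.w, hν]
  have hz' : ((precomp ι).map (coreprDesc z')).hom.app P (coreprElem ι (p.ι.app k)) =
      j.hom.app P x := by
    rw [coreprDesc_app, ← hz, ← p.w (homOfLE hk₂), X.obj.map_comp, comp_apply]
  obtain ⟨l, f, hf⟩ := exists_coreprMap_comp_eq p (ν' ≫ j) ((precomp ι).map (coreprDesc z'))
    ((congrArg (j.hom.app P) hν').trans hz'.symm)
  refine ⟨_, hp l, X.obj.map (p.diag.map f) z', (precomp ι).map (coreprMap (p.diag.map f)) ≫ ν',
    surjective_of_app_coreprElem_eq ι hx _ (b := p.ι.app l) ?_, ?_⟩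
  · rw [coreprMap_comp_app, p.w, hν']
  · rw [Category.assoc, hf, ← Functor.map_comp, coreprMap_comp_coreprDesc]

theorem isCovering : IsCovering (precomp ι) := by
  refine ⟨fun F => ?_, fun {X W} j _ => ?_⟩
  · obtain ⟨C, _, ν, hν⟩ := hN.exists_surjective F
    exact ⟨corepr C, ν, Plus.isRegularEpi_of_surjective hν⟩
  · obtain ⟨C, _, z, e, he, h⟩ := hN.exists_surjective_comp_eq j
    exact ⟨corepr C, coreprDesc z, e, Plus.isRegularEpi_of_surjective he, h⟩

theorem essentiallySmall : EssentiallySmall.{u} (Plus M) := by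
  obtain ⟨S, R, hR, hR'⟩ :=
    exists_small_family_of_essentiallySmall (ObjectProperty.isFinitelyPresentable.{u} K)
  have (s : S) : IsFinitelyPresentable.{u} (R s) := hR s
  refine hN.essentiallySmall_of_exists_surjective (fun s => (precomp ι).obj (corepr (R s)))
    fun F => ?_
  obtain ⟨C, hC, ν, hν⟩ := hN.exists_surjective F
  obtain ⟨s, ⟨e⟩⟩ := hR' C hC
  refine ⟨s, (precomp ι).map (coreprMap e.hom) ≫ ν, fun X y => ?_⟩
  obtain ⟨x, rfl⟩ := hν X y
  obtain ⟨b, rfl⟩ := exists_coreprElem_eq ι x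
  exact ⟨coreprElem ι (e.inv ≫ b), by rw [coreprMap_comp_app, e.hom_inv_id_assoc]⟩

end IsTestFamily

/-! ### Definable subcategories -/

theorem isRegularFunctor_precomp {K : Type w} [Category.{u} K] {M : Type a} [Category.{u} M]
    (ι : M ⥤ K) [PreservesProductsAndDirectedColimits ι] : IsRegularFunctor (precomp ι) where
  lex := by
    have : PreservesFiniteLimits ((Functor.whiskeringLeft _ _ (Type u)).obj ι) :=
      ⟨fun _ => inferInstance⟩
    have : PreservesFiniteLimits (precomp ι ⋙ (IsInterpretation M).ι) :=
      inferInstanceAs (PreservesFiniteLimits ((IsInterpretation K).ι ⋙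
        (Functor.whiskeringLeft _ _ _).obj ι))
    exact preservesFiniteLimits_of_reflects_of_preserves _ (IsInterpretation M).ι
  regularEpi _ _ f _ := Plus.isRegularEpi_of_surjective fun X =>
    Plus.surjective_of_isRegularEpi f (ι.obj X)

theorem IsTestFamily.of_presentations {K : Type w} [Category.{u} K] {M : Type a} [Category.{u} M]
    {ι : M ⥤ K} [PreservesProductsAndDirectedColimits ι] [ι.Full] [ι.Faithful]
    {T : Type u} {N : T → M} (κ : Cardinal.{u}) [Fact κ.IsRegular]
    [∀ t, IsCardinalPresentable (ι.obj (N t)) κ]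
    (h : ∀ X : M, ∃ (G : Type u) (_ : PartialOrder G) (_ : IsCardinalFiltered G κ)
      (p : ColimitPresentation G X),
      ∀ g, Mono (ι.map (p.ι.app g)) ∧ ∃ t, Nonempty (p.diag.obj g ≅ N t)) :
    IsTestFamily ι N := by
  have directed (G : Type u) [PartialOrder G] [IsFiltered G] : IsDirectedOrder G :=
    ⟨fun i j => ⟨_, leOfHom (IsFiltered.leftToMax i j), leOfHom (IsFiltered.rightToMax i j)⟩⟩
  refine ⟨fun {F} hF X x => ?_, fun {X s t} f g => ?_⟩
  all_goals
    obtain ⟨G, _, _, p, hp⟩ := h X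
    have := isFiltered_of_isCardinalFiltered G κ
    have := directed G
    have : Nonempty G := IsFiltered.nonempty
  · obtain ⟨j, y, rfl⟩ := hF.exists_rep p.isColimit x
    obtain ⟨t, ⟨e⟩⟩ := (hp j).2
    refine ⟨t, e.inv ≫ p.ι.app j, F.map e.hom y, ?_⟩
    rw [← comp_apply, ← Functor.map_comp, Iso.hom_inv_id_assoc]
  · have exists_lift {s : T} (f : N s ⟶ X) : ∃ (i : G) (f' : N s ⟶ p.diag.obj i),
        f' ≫ p.ι.app i = f := by
      obtain ⟨i, f', hf⟩ := IsCardinalPresentable.exists_hom_of_isColimit κ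
        (isColimitOfPreserves ι p.isColimit) (ι.map f)
      obtain ⟨f', rfl⟩ := ι.map_surjective f'
      exact ⟨i, f', ι.map_injective ((ι.map_comp _ _).trans hf)⟩
    obtain ⟨i, f', rfl⟩ := exists_lift f
    obtain ⟨j, g', rfl⟩ := exists_lift g
    obtain ⟨hm, r, ⟨e⟩⟩ := hp (IsFiltered.max i j)
    refine ⟨r, e.inv ≫ p.ι.app _, f' ≫ p.diag.map (IsFiltered.leftToMax i j) ≫ e.hom,
      g' ≫ p.diag.map (IsFiltered.rightToMax i j) ≫ e.hom, ?_, ?_, ?_⟩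
    · rw [Functor.map_comp]
      infer_instance
    all_goals simp only [Category.assoc, Iso.hom_inv_id_assoc, p.w]

namespace IsDefinable

variable {K : Type w} [Category.{u} K]

variable (K) in
theorem top : IsDefinable (⊤ : ObjectProperty K) where
  products _ := ⟨fun _ _ => trivial⟩
  directedColimits _ _ _ _ := ⟨fun _ _ => trivial⟩
  pureSubobjects _ _ _ _ _ _ := trivial

variable [IsLocallyFinitelyPresentable.{u} K] {L : ObjectProperty K} (hL : IsDefinable L)
include hL

theorem hasProducts : HasProducts.{u} L.FullSubcategory := fun J => by
  have := hasLimits_of_lfp (K := K)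
  have := hL.products J
  exact hasLimitsOfShape_of_closedUnderLimits _ L

theorem hasDirectedColimits : HasDirectedColimits L.FullSubcategory where
  hasColimitsOfShape J _ _ _ := by
    have := hL.directedColimits J
    exact hasColimitsOfShape_of_closedUnderColimits _ L

theorem preservesProductsAndDirectedColimits_ι : PreservesProductsAndDirectedColimits L.ι where
  products J := by
    have := hasLimits_of_lfp (K := K)
    have := hL.products J
    exact ⟨fun {D} => by
      have := createsLimitFullSubcategoryInclusion D (L.prop_limit _ fun j => (D.obj j).property)
      infer_instance⟩
  directedColimits J _ _ _ := by
    have := hL.directedColimits J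
    exact ⟨fun {D} => by
      have := createsColimitFullSubcategoryInclusion D
        (L.prop_colimit _ fun j => (D.obj j).property)
      infer_instance⟩

attribute [local instance] Cardinal.fact_isRegular_aleph0 in
theorem exists_isTestFamily :
    ∃ (T : Type u) (N : T → L.FullSubcategory), IsTestFamily L.ι N := by
  obtain ⟨κ, _, hκ, h⟩ := exists_pure_presentation (K := K)
  have : IsCardinalLocallyPresentable K κ := IsCardinalLocallyPresentable.of_le K hκ
  have : ObjectProperty.EssentiallySmall.{u} (isCardinalPresentable K κ ⊓ L) :=
    ObjectProperty.EssentiallySmall.of_le inf_le_left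
  obtain ⟨T, S, hS, hS'⟩ :=
    exists_small_family_of_essentiallySmall (isCardinalPresentable K κ ⊓ L)
  let N (t : T) : L.FullSubcategory := ⟨S t, (hS t).2⟩
  have (t : T) : IsCardinalPresentable (L.ι.obj (N t)) κ := (hS t).1
  have := hL.preservesProductsAndDirectedColimits_ι
  refine ⟨T, N, IsTestFamily.of_presentations κ fun X => ?_⟩
  obtain ⟨G, _, _, p, hp⟩ := h X.obj
  have hL' (g : G) : L (p.diag.obj g) :=
    have := (hp g).2.mono
    hL.pureSubobjects (p.ι.app g) (hp g).2 X.property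
  let q : ColimitPresentation G X :=
    { diag := L.lift p.diag hL'
      ι :=
        { app g := ObjectProperty.homMk (p.ι.app g)
          naturality _ _ f := ObjectProperty.hom_ext _ (p.ι.naturality f) }
      isColimit := isColimitOfReflects L.ι p.isColimit }
  refine ⟨G, _, ‹_›, q, fun g => ⟨(hp g).2.mono, ?_⟩⟩
  obtain ⟨t, ⟨e⟩⟩ := hS' (p.diag.obj g) ⟨(hp g).1, hL' g⟩
  exact ⟨t, ⟨L.isoMk e⟩⟩

theorem isCovering_restriction : IsCovering (restriction hL) := by
  have := hL.hasProducts
  have := hL.hasDirectedColimits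
  have := hL.preservesProductsAndDirectedColimits_ι
  obtain ⟨T, N, hN⟩ := hL.exists_isTestFamily
  exact hN.isCovering

theorem isRegularFunctor_restriction : IsRegularFunctor (restriction hL) :=
  have := hL.preservesProductsAndDirectedColimits_ι
  isRegularFunctor_precomp L.ι

theorem isSmallExact_plus_fullSubcategory : IsSmallExact.{u} (Plus L.FullSubcategory) := by
  have := hL.hasProducts
  have := hL.hasDirectedColimits
  have := hL.preservesProductsAndDirectedColimits_ι
  obtain ⟨T, N, hN⟩ := hL.exists_isTestFamily
  exact ⟨hN.essentiallySmall, Plus.isExact _⟩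

end IsDefinable

theorem isSmallExact_plus (K : Type w) [Category.{u} K] [IsLocallyFinitelyPresentable.{u} K] :
    IsSmallExact.{u} (Plus K) := by
  have : (⊤ : ObjectProperty K).ι.IsEquivalence :=
    { essSurj := ⟨fun X => ⟨⟨X, trivial⟩, ⟨Iso.refl _⟩⟩⟩ }
  have : ((Functor.whiskeringLeft _ _ (Type u)).obj (⊤ : ObjectProperty K).ι).IsEquivalence :=
    inferInstance
  have : (restriction (IsDefinable.top K)).Full :=
    inferInstanceAs (ObjectProperty.lift _ _ _).Full
  have : (restriction (IsDefinable.top K)).Faithful :=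
    inferInstanceAs (ObjectProperty.lift _ _ _).Faithful
  have := (IsDefinable.top K).isSmallExact_plus_fullSubcategory.small
  exact ⟨essentiallySmall_of_fully_faithful (restriction (IsDefinable.top K)), Plus.isExact K⟩

end DefinableCat

theorem corollary3p2p3_general {K : Type w} [CategoryTheory.Category.{u} K]
    [CategoryTheory.IsLocallyFinitelyPresentable.{u} K]
    (L : CategoryTheory.ObjectProperty K) (hL : DefinableCat.IsDefinable L) :
    DefinableCat.IsSmallExact.{u} (DefinableCat.Plus K) ∧
      DefinableCat.IsSmallExact.{u} (DefinableCat.Plus L.FullSubcategory) ∧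
      DefinableCat.IsRegularFunctor (DefinableCat.restriction hL) ∧
      ∀ (B : Type a) [Category.{b} B] (P₁ P₂ : DefinableCat.Plus L.FullSubcategory ⥤ B),
        DefinableCat.IsRegularFunctor P₁ →
        ∀ α : DefinableCat.restriction hL ⋙ P₁ ⟶ DefinableCat.restriction hL ⋙ P₂,
          ∃! β : P₁ ⟶ P₂, Functor.whiskerLeft (DefinableCat.restriction hL) β = α := by
  have hQ := hL.isRegularFunctor_restriction
  have hPlus := hL.isSmallExact_plus_fullSubcategory
  refine ⟨DefinableCat.isSmallExact_plus K, hPlus, hQ, fun B _ P₁ P₂ hP₁ α => ?_⟩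
  have := hQ.lex
  have := hPlus.exact.regular
  exact hL.isCovering_restriction.existsUnique_whiskerLeft_eq hP₁ P₂ α

theorem corollary3p2p3 {K : Type w} [CategoryTheory.Category.{u} K]
    [CategoryTheory.IsLocallyFinitelyPresentable.{u} K]
    (L : CategoryTheory.ObjectProperty K) (hL : DefinableCat.IsDefinable L) :
    DefinableCat.IsEpiEX.{u, a, b} (DefinableCat.restriction hL) :=
  have ⟨hK, hPlus, hQ, epi⟩ := corollary3p2p3_general L hL
  ⟨hK, hPlus, hQ, fun B _ _ P₁ P₂ hP₁ _ α => epi B P₁ P₂ hP₁ α⟩
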